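/- Let $1\le n\le k$ be integers and let $S_k$ act on $X=[k]^n$ by permuting values, $(g\cdot x)_i=g(x_i)$. For $g\in S_k$ and $x\in X$ put $X_g=\{x\in X: g\cdot x=x\}$ and $G_x=\{g\in S_k: g\cdot x=x\}$, and let $Q$ be the dual Burnside chain, i.e. the Markov chain on $G^*=\{g\in S_k: X_g\neq\emptyset\}$ with transition kernel $$Q(g,h)=\sum_{x\in X_g\cap X_h}\frac1{|X_g|}\cdot\frac1{|G_x|}.$$ Let $\pi$ be the stationary distribution of $Q$ on $G^*$, let $\|\mu-\nu\|_{\mathrm{TV}}=\frac12\sum_{g}|\mu(g)-\nu(g)|$, and put $d_Q(t)=\max_{g\in G^*}\|Q^t(g,\cdot)-\pi\|_{\mathrm{TV}}$ and $t_{\mathrm{mix}}(Q;\varepsilon)=\min\{t\ge 0: d_Q(t)\le\varepsilon\}$. Then $$d_Q(t)\le n\Bigl(1-\frac1{2k}\Bigr)^{t-1}\quad\text{for all integers } t\ge 1,$$ and $$t_{\mathrm{mix}}(Q;\varepsilon)\le 1+\Bigl\lceil 2k\log\frac n\varepsilon\Bigr\rceil\quad\text{for all } \varepsilon\in(0,1).$$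 -/

import Mathlib

noncomputable section

/-! ### Finite Markov chains -/

/-- Total variation distance `(1/2) ∑ |μ s - ν s|` between two vectors on a finite set. -/
def tvDist {S : Type*} [Fintype S] (μ ν : S → ℝ) : ℝ :=
  (1 / 2) * ∑ s, |μ s - ν s|

/-- `π` is a stationary probability distribution of the transition matrix `P`: `π P = π`. -/
def IsStationaryDist {S : Type*} [Fintype S] (P : Matrix S S ℝ) (π : S → ℝ) : Prop :=
  (∀ s, 0 ≤ π s) ∧ ∑ s, π s = 1 ∧ Matrix.vecMul π P = π

open Classical in
/-- The worst-case distance to stationarity `d_P(t) = max_x ‖P^t(x, ·) - π‖_TV`. -/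
def worstDist {S : Type*} [Fintype S] (P : Matrix S S ℝ) (π : S → ℝ) (t : ℕ) : ℝ :=
  ⨆ x : S, tvDist (fun y => (P ^ t) x y) π

/-- The mixing time `t_mix(P; ε) = min {t ≥ 0 : d_P(t) ≤ ε}`, with the value `⊤` if there is
no such `t`. -/
def mixingTime {S : Type*} [Fintype S] (P : Matrix S S ℝ) (π : S → ℝ) (ε : ℝ) : ℕ∞ :=
  ⨅ (t : ℕ) (_ : worstDist P π t ≤ ε), (t : ℕ∞)

/-! ### The dual Burnside process -/

/-- The state space `G* = {g ∈ G : X_g ≠ ∅}` of the dual Burnside process. -/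
abbrev DualState (G X : Type*) [Group G] [MulAction G X] : Type _ :=
  {g : G // (MulAction.fixedBy X g).Nonempty}

instance dualStateFintype (G X : Type*) [Group G] [MulAction G X] [Fintype G] :
    Fintype (DualState G X) :=
  Fintype.ofFinite _

open Classical in
/-- The dual Burnside kernel `Q(g, h) = ∑_{x ∈ X_g ∩ X_h} (1 / |X_g|) * (1 / |G_x|)`. -/
def dualBurnside (G X : Type*) [Group G] [MulAction G X] [Fintype G] [Fintype X] :
    Matrix (DualState G X) (DualState G X) ℝ :=
  fun g h =>
    ∑ x : X with x ∈ MulAction.fixedBy X g.1 ∩ MulAction.fixedBy X h.1,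
      1 / (Nat.card (MulAction.fixedBy X g.1) : ℝ) *
        (1 / (Nat.card (MulAction.stabilizer G x) : ℝ))

open Classical in
/-- The dual Burnside kernel is row-stochastic. -/
theorem dualBurnside_row_sum {G X : Type*} [Group G] [MulAction G X] [Fintype G] [Fintype X]
    (g : DualState G X) : ∑ h, dualBurnside G X g h = 1 := by
  have hstab : ∀ x : X, ∑ h : DualState G X,
      (if x ∈ MulAction.fixedBy X h.1 then (1 : ℝ) else 0) =
        Nat.card (MulAction.stabilizer G x) := by
    intro x
    rw [Finset.sum_boole, ← Fintype.card_subtype, ← Nat.card_eq_fintype_card]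
    congr 1
    refine Nat.card_congr ⟨fun h => ⟨h.1.1, h.2⟩, fun h => ⟨⟨h.1, ⟨x, h.2⟩⟩, h.2⟩, ?_, ?_⟩
    · intro h; rfl
    · intro h; rfl
  have hpos : ∀ x : X, (Nat.card (MulAction.stabilizer G x) : ℝ) ≠ 0 := by
    intro x
    exact_mod_cast Nat.card_pos.ne'
  have hg : (Nat.card (MulAction.fixedBy X g.1) : ℝ) ≠ 0 := by
    have : Nonempty (MulAction.fixedBy X g.1) := g.2.to_subtype
    exact_mod_cast Nat.card_pos.ne'
  have key : ∀ h : DualState G X, dualBurnside G X g h =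
      ∑ x : X with x ∈ MulAction.fixedBy X g.1,
        (1 / (Nat.card (MulAction.fixedBy X g.1) : ℝ) *
          (1 / (Nat.card (MulAction.stabilizer G x) : ℝ))) *
          (if x ∈ MulAction.fixedBy X h.1 then (1 : ℝ) else 0) := by
    intro h
    simp only [dualBurnside, Set.mem_inter_iff, mul_ite, mul_one, mul_zero]
    rw [← Finset.filter_filter, Finset.sum_filter]
  simp only [key]
  rw [Finset.sum_comm]
  simp only [← Finset.mul_sum, hstab]
  have : ∀ x : X, 1 / (Nat.card (MulAction.fixedBy X g.1) : ℝ) *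
      (1 / (Nat.card (MulAction.stabilizer G x) : ℝ)) *
      (Nat.card (MulAction.stabilizer G x) : ℝ) =
        1 / (Nat.card (MulAction.fixedBy X g.1) : ℝ) := by
    intro x
    have := hpos x
    field_simp
  simp only [this, Finset.sum_const, nsmul_eq_mul]
  rw [← Fintype.card_subtype, ← Nat.card_eq_fintype_card]
  exact mul_one_div_cancel hg

/-- The law `π(g) = |X_g| / ∑_h |X_h|` is stationary for the dual Burnside kernel, so the chain
has a stationary distribution. -/
theorem dualBurnside_isStationary (G X : Type*) [Group G] [MulAction G X] [Fintype G]
    [Fintype X] [Nonempty X] :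
    IsStationaryDist (dualBurnside G X) (fun g =>
      (Nat.card (MulAction.fixedBy X g.1) : ℝ) /
        ∑ h : DualState G X, (Nat.card (MulAction.fixedBy X h.1) : ℝ)) := by
  classical
  have hc : ∀ g : DualState G X, (0 : ℝ) < Nat.card (MulAction.fixedBy X g.1) := by
    intro g
    have : Nonempty (MulAction.fixedBy X g.1) := g.2.to_subtype
    exact_mod_cast Nat.card_pos
  have : Nonempty (DualState G X) := ⟨⟨1, by simp⟩⟩
  have hZ : (0 : ℝ) < ∑ h : DualState G X, (Nat.card (MulAction.fixedBy X h.1) : ℝ) :=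
    Finset.sum_pos (fun h _ => hc h) Finset.univ_nonempty
  refine ⟨fun g => (div_pos (hc g) hZ).le, ?_, ?_⟩
  · rw [← Finset.sum_div, div_self hZ.ne']
  · have hrev : ∀ g h : DualState G X,
        (Nat.card (MulAction.fixedBy X g.1) : ℝ) * dualBurnside G X g h =
          (Nat.card (MulAction.fixedBy X h.1) : ℝ) * dualBurnside G X h g := by
      intro g h
      simp only [dualBurnside, Finset.mul_sum]
      refine Finset.sum_congr (Finset.filter_congr fun x _ => And.comm) fun x _ => ?_
      have h1 := (hc g).ne'
      have h2 := (hc h).ne'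
      rw [← mul_assoc, ← mul_assoc, mul_one_div_cancel h1, mul_one_div_cancel h2]
    funext h
    simp only [Matrix.vecMul, dotProduct, div_mul_eq_mul_div, hrev _ h]
    rw [← Finset.sum_div, ← Finset.mul_sum, dualBurnside_row_sum, mul_one]

/-! ### The value-permutation model -/

/-- The dual Burnside kernel of the value-permutation model: the symmetric group `S_k` acts on
the words `[k]^n` by permuting the values, `(g • x) i = g (x i)`. -/
def valueDual (n k : ℕ) : Matrix (DualState (Equiv.Perm (Fin k)) (Fin n → Fin k))
    (DualState (Equiv.Perm (Fin k)) (Fin n → Fin k)) ℝ :=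
  dualBurnside (Equiv.Perm (Fin k)) (Fin n → Fin k)

/-- The action used in `valueDual` is the action on values. -/
theorem value_smul_apply {n k : ℕ} (g : Equiv.Perm (Fin k)) (x : Fin n → Fin k) (i : Fin n) :
    (g • x) i = g (x i) :=
  rfl

end

/-!
A step of the dual Burnside chain from `g` picks a uniform word `x` in the fixed points of `g`, and
then a uniform permutation fixing the set `V` of values of `x` pointwise. So `s + 1` steps are a
word, then `s` steps of the chain of value sets `V` (`setStep`), then a permutation
(`valueDual_pow_succ_mulVec`). It suffices to bound the oscillation of `setStep^[s] Φ` over nonempty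
sets of at most `n` values, for `Φ` with values in `[0, 1]`, by `n q` with
`q = (1 - 1 / (2 k)) ^ s` (`abs_iterate_setStep_sub_le`). If `n q ≥ 1` this is trivial. Otherwise
any decay faster than `q` gains a power of `n`, which pays for lossy constants. There are two
contributions.

* Sets of equal size. If `V` and `W` differ by replacing `a` by `b`, use conjugate permutations and
  words. The images agree as soon as `b` is fixed, which has probability at least `1 / k`. Thus the
  variation under replacing a value decays like `(1 - 1 / k) ^ s ≤ q ^ 2` (`setStep_swap`).

* Sizes. After averaging over renamings of the values only `j = |V|` matters, and the chain becomes
  `sizeStep`: from `j` pass to `f = j + N`, where `N` is the number of fixed points of a uniform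
  permutation of `k - j` points, and then to the number of occupied boxes when `n` balls are thrown
  into `f` boxes. Both parts preserve monotonicity, so a function whose increments are bounded by
  those of a potential `W` stays so bounded, with `W` replaced by its image. For
  `W j = M j - j (j - 1) / 2`, with increments `M - j`, the first part lowers the increments by `1`
  because `N` has mean `1` and second moment `2` (the largest `j` need separate care), and the
  second part does not raise them if `M = 4 k / 3` (`occMean_quadPot_sub_le`). Hence the differences decay like
  `(1 - 3 / (4 k)) ^ s ≤ q ^ (3 / 2)` (`sizeStep_contraction`). For `n ≤ 3` the potential `W j = j`
  serves.

The mixing time bound follows from `1 - x ≤ exp (-x)`.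
-/

noncomputable section

open Finset

/-! ### Occupied boxes -/

/-- Expected value of `g` at the number of occupied boxes after `r` balls have been thrown
independently and uniformly into `f` boxes of which `i` are occupied beforehand, computed one
ball at a time. It has this meaning for `1 ≤ f` and `i ≤ f`; `f = 0` and `i > f` are not used. -/
def occMean (f : ℕ) (g : ℕ → ℝ) : ℕ → ℕ → ℝ
  | 0, i => g i
  | r + 1, i => (i / f : ℝ) * occMean f g r i + (1 - i / f : ℝ) * occMean f g r (i + 1)

theorem occMean_linear (f : ℕ) (a b : ℝ) (g h : ℕ → ℝ) (r i : ℕ) :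
    occMean f (fun j => a * g j + b * h j) r i =
      a * occMean f g r i + b * occMean f h r i := by
  induction r generalizing i with
  | zero => rfl
  | succ r ih => simp only [occMean, ih]; ring

/-- Eigenfunctions of the one-ball operator. -/
theorem occMean_eigen (f : ℕ) (g : ℕ → ℝ) (c : ℝ)
    (h : ∀ i : ℕ, (i / f : ℝ) * g i + (1 - i / f : ℝ) * g (i + 1) = c * g i) (r i : ℕ) :
    occMean f g r i = c ^ r * g i := by
  induction r generalizing i with
  | zero => simp [occMean]
  | succ r ih =>
    simp only [occMean, ih]
    calc _ = c ^ r * ((i / f : ℝ) * g i + (1 - i / f : ℝ) * g (i + 1)) := by ring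
      _ = _ := by rw [h, pow_succ]; ring

theorem occMean_const (f : ℕ) (r i : ℕ) (c : ℝ) : occMean f (fun _ => c) r i = c := by
  rw [occMean_eigen f (fun _ => c) 1 (fun i => by ring)]; simp

/-- The number of empty boxes is multiplied by `1 - 1 / f` in mean by each ball. -/
theorem occMean_empty {f : ℕ} (hf : f ≠ 0) (r i : ℕ) :
    occMean f (fun j => (f : ℝ) - j) r i = (1 - 1 / f : ℝ) ^ r * (f - i) := by
  have hf' : (f : ℝ) ≠ 0 := by exact_mod_cast hf
  apply occMean_eigen f (fun j => (f : ℝ) - j)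
  intro i
  push_cast
  field_simp
  ring

/-- The number of ordered pairs of empty boxes is multiplied by `1 - 2 / f` in mean. -/
theorem occMean_empty_pairs {f : ℕ} (hf : f ≠ 0) (r i : ℕ) :
    occMean f (fun j => ((f : ℝ) - j) * (f - j - 1)) r i =
      (1 - 2 / f : ℝ) ^ r * ((f - i) * (f - i - 1)) := by
  have hf' : (f : ℝ) ≠ 0 := by exact_mod_cast hf
  apply occMean_eigen f (fun j => ((f : ℝ) - j) * (f - j - 1))
  intro i
  push_cast
  field_simp
  ring

/-- For an increasing `g`, the mean increases with the number of boxes occupied beforehand. As at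
most `n` boxes get occupied, only the increments of `g` at `1 ≤ j < n` matter. -/
theorem occMean_mono_start {f n : ℕ} {g : ℕ → ℝ}
    (hg : ∀ j, 1 ≤ j → j < n → g j ≤ g (j + 1)) (r i : ℕ) (hi : 1 ≤ i) (hif : i < f)
    (hin : i + r < n) : occMean f g r i ≤ occMean f g r (i + 1) := by
  induction r generalizing i with
  | zero => exact hg i hi (by omega)
  | succ r ih =>
    have hf : (0 : ℝ) < f := by exact_mod_cast (by omega : 0 < f)
    have h1 := ih i hi hif (by omega)
    have key : occMean f g (r + 1) (i + 1) - occMean f g (r + 1) i =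
        (1 - ((i + 1 : ℕ) : ℝ) / f) * (occMean f g r (i + 1 + 1) - occMean f g r (i + 1)) +
          (i / f : ℝ) * (occMean f g r (i + 1) - occMean f g r i) := by
      simp only [occMean]; push_cast; ring
    have h2 : 0 ≤ (i / f : ℝ) * (occMean f g r (i + 1) - occMean f g r i) :=
      mul_nonneg (by positivity) (by linarith)
    have h3 : 0 ≤ (1 - ((i + 1 : ℕ) : ℝ) / f) *
        (occMean f g r (i + 1 + 1) - occMean f g r (i + 1)) := by
      rcases Nat.lt_or_ge (i + 1) f with h | h
      · refine mul_nonneg ?_ (by linarith [ih (i + 1) (by omega) h (by omega)])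
        rw [sub_nonneg, div_le_one hf]; exact_mod_cast h.le
      -- With `i + 1 = f` all boxes are occupied: the value at `i + 2` has weight `0`.
      · have : i + 1 = f := by omega
        rw [this, div_self hf.ne']; simp
    linarith

/-- For an increasing `g`, the mean of `g` at the number of occupied boxes increases with the
number of boxes. -/
theorem occMean_mono_boxes {f n : ℕ} {g : ℕ → ℝ}
    (hg : ∀ j, 1 ≤ j → j < n → g j ≤ g (j + 1)) (r i : ℕ) (hi : 1 ≤ i) (hif : i ≤ f)
    (hin : i + r ≤ n) : occMean f g r i ≤ occMean (f + 1) g r i := by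
  induction r generalizing i with
  | zero => exact le_rfl
  | succ r ih =>
    have hf : (0 : ℝ) < f := by exact_mod_cast (by omega : 0 < f)
    have key : occMean (f + 1) g (r + 1) i - occMean f g (r + 1) i =
        (i / f : ℝ) * (occMean (f + 1) g r i - occMean f g r i) +
        (1 - i / f : ℝ) * (occMean (f + 1) g r (i + 1) - occMean f g r (i + 1)) +
        (i / f - i / ((f + 1 : ℕ) : ℝ)) *
          (occMean (f + 1) g r (i + 1) - occMean (f + 1) g r i) := by
      simp only [occMean]; ring
    have h1 : 0 ≤ (i / f : ℝ) * (occMean (f + 1) g r i - occMean f g r i) :=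
      mul_nonneg (by positivity) (by linarith [ih i hi hif (by omega)])
    have h2 : 0 ≤ (1 - i / f : ℝ) * (occMean (f + 1) g r (i + 1) - occMean f g r (i + 1)) := by
      rcases Nat.lt_or_ge i f with h | h
      · refine mul_nonneg ?_ (by linarith [ih (i + 1) (by omega) h (by omega)])
        rw [sub_nonneg, div_le_one hf]; exact_mod_cast h.le
      · have : i = f := by omega
        rw [this, div_self hf.ne']; simp
    have h3 : 0 ≤ (i / f - i / ((f + 1 : ℕ) : ℝ)) *
          (occMean (f + 1) g r (i + 1) - occMean (f + 1) g r i) := by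
      refine mul_nonneg ?_ (by
        linarith [occMean_mono_start (f := f + 1) hg r i hi (by omega) (by omega)])
      rw [sub_nonneg]
      apply div_le_div_of_nonneg_left (by positivity) hf
      push_cast; linarith
    linarith

theorem occMean_zero (f n : ℕ) (hn : 1 ≤ n) (g : ℕ → ℝ) :
    occMean f g n 0 = occMean f g (n - 1) 1 := by
  obtain ⟨r, rfl⟩ : ∃ r, n = r + 1 := ⟨n - 1, by omega⟩
  simp [occMean]

/-- If the increments of `g` are at most `L` times those of `W`, then adding a box changes the
mean of `g` by at most `L` times the change of the mean of `W`. -/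
theorem abs_occMean_sub_le {f n : ℕ} (hn : 1 ≤ n) (hf : 1 ≤ f) {g W : ℕ → ℝ} {L : ℝ}
    (hg : ∀ j, 1 ≤ j → j < n → |g (j + 1) - g j| ≤ L * (W (j + 1) - W j)) :
    |occMean (f + 1) g n 0 - occMean f g n 0| ≤
      L * (occMean (f + 1) W n 0 - occMean f W n 0) := by
  simp only [occMean_zero _ n hn]
  have h1 := occMean_mono_boxes (f := f) (n := n) (g := fun j => L * W j + 1 * g j)
    (fun j h1 h2 => by have := abs_le.1 (hg j h1 h2); linarith) (n - 1) 1 le_rfl hf (by omega)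
  have h2 := occMean_mono_boxes (f := f) (n := n) (g := fun j => L * W j + (-1) * g j)
    (fun j h1 h2 => by have := abs_le.1 (hg j h1 h2); linarith) (n - 1) 1 le_rfl hf (by omega)
  simp only [occMean_linear] at h1 h2
  rw [abs_le]; constructor <;> linarith

/-! ### Fixed points of a uniform permutation -/

/-- The set of fixed points of a permutation. -/
def fixedPts {α : Type*} [Fintype α] [DecidableEq α] (σ : Equiv.Perm α) : Finset α :=
  univ.filter fun a => σ a = a

@[simp] theorem mem_fixedPts {α : Type*} [Fintype α] [DecidableEq α] {σ : Equiv.Perm α} {a : α} :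
    a ∈ fixedPts σ ↔ σ a = a := by
  simp [fixedPts]

/-- The mean of `g` at the number of fixed points of a uniform permutation of `m` points. -/
def fixMean (m : ℕ) (g : ℕ → ℝ) : ℝ :=
  (∑ σ : Equiv.Perm (Fin m), g #(fixedPts σ)) / m.factorial

theorem sum_perm_fixedPts {β : Type*} [Fintype β] [DecidableEq β] (g : ℕ → ℝ) :
    ∑ σ : Equiv.Perm β, g #(fixedPts σ) =
      (Fintype.card β).factorial * fixMean (Fintype.card β) g := by
  rw [fixMean, mul_div_cancel₀ _ (by positivity)]
  let e := Fintype.equivFin β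
  refine Fintype.sum_equiv e.permCongr _ _ fun σ => ?_
  congr 1
  refine card_bij (fun a _ => e a) ?_ (fun a _ b _ h => e.injective h) ?_
  · intro a ha; simpa using ha
  · intro b hb
    refine ⟨e.symm b, ?_, by simp⟩
    rw [mem_fixedPts] at hb ⊢
    apply e.injective
    simpa using hb

theorem fixMean_linear (m : ℕ) (a b : ℝ) (g h : ℕ → ℝ) :
    fixMean m (fun N => a * g N + b * h N) = a * fixMean m g + b * fixMean m h := by
  simp only [fixMean, sum_add_distrib, ← mul_sum]; ring

theorem fixMean_mono {m : ℕ} {g h : ℕ → ℝ} (H : ∀ N ≤ m, g N ≤ h N) :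
    fixMean m g ≤ fixMean m h := by
  refine div_le_div_of_nonneg_right (sum_le_sum fun σ _ => H _ ?_) (by positivity)
  simpa using card_le_univ (fixedPts σ)

theorem fixMean_const (m : ℕ) (c : ℝ) : fixMean m (fun _ => c) = c := by
  have : (m.factorial : ℝ) ≠ 0 := by positivity
  simp [fixMean, Fintype.card_perm]
  field_simp

/-- Fixed points after inserting the point `none` into the permutation `e` in all possible ways. -/
theorem fixedPts_decomposeOption {β : Type*} [Fintype β] [DecidableEq β] (e : Equiv.Perm β)
    (g : ℕ → ℝ) :
    ∑ i : Option β, g #(fixedPts (Equiv.Perm.decomposeOption.symm (i, e))) =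
      g (#(fixedPts e) + 1) + #(fixedPts e) * g (#(fixedPts e) - 1) +
        (Fintype.card β - #(fixedPts e)) * g #(fixedPts e) := by
  have hnone : fixedPts (Equiv.Perm.decomposeOption.symm (none, e)) =
      insertNone (fixedPts e) := by
    ext a; cases a <;> simp
  have hsome : ∀ c : β, fixedPts (Equiv.Perm.decomposeOption.symm (some c, e)) =
      ((fixedPts e).erase c).map Function.Embedding.some := by
    intro c
    ext a
    cases a with
    | none => simp
    | some a =>
      simp only [mem_fixedPts, Equiv.Perm.decomposeOption_symm_apply, Equiv.Perm.coe_mul,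
        Function.comp, Equiv.optionCongr_apply, Option.map_some, mem_map, mem_erase,
        Function.Embedding.some_apply, Option.some.injEq, exists_eq_right]
      by_cases h : e a = c
      · subst h
        simp
        intro h1 h2; exact h1 h2.symm
      · rw [Equiv.swap_apply_of_ne_of_ne (by simp) (by simpa using h)]
        simp only [Option.some.injEq]
        constructor
        · intro h2; exact ⟨fun h3 => h (by rw [h2, h3]), h2⟩
        · exact fun h2 => h2.2
  rw [Fintype.sum_option, hnone, card_insertNone]
  simp only [hsome, card_map]
  rw [add_assoc]
  congr 1
  rw [← sum_add_sum_compl (fixedPts e)]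
  congr 1
  · rw [sum_congr rfl fun c hc => by rw [card_erase_of_mem hc], sum_const, nsmul_eq_mul]
  · rw [sum_congr rfl fun c hc => by rw [erase_eq_of_notMem (mem_compl.1 hc)], sum_const,
      nsmul_eq_mul, card_compl, Nat.cast_sub (card_le_univ _)]

/-- Inserting one more point into a uniform permutation: it becomes a fixed point, destroys one
of the `N` fixed points, or changes nothing. -/
theorem fixMean_succ (m : ℕ) (g : ℕ → ℝ) :
    (m + 1 : ℝ) * fixMean (m + 1) g =
      fixMean m (fun N => g (N + 1) + N * g (N - 1) + (m - N) * g N) := by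
  have h := sum_perm_fixedPts (β := Option (Fin m)) g
  rw [← Equiv.sum_comp Equiv.Perm.decomposeOption.symm, Fintype.sum_prod_type,
    sum_comm] at h
  simp only [fixedPts_decomposeOption, Fintype.card_option, Fintype.card_fin] at h
  rw [fixMean.eq_1 m, h, Nat.factorial_succ]
  have : (m.factorial : ℝ) ≠ 0 := by positivity
  push_cast
  field_simp

/-- A uniform permutation of a nonempty set has one fixed point on average. -/
theorem fixMean_id {m : ℕ} (hm : 1 ≤ m) : fixMean m (fun N => (N : ℝ)) = 1 := by
  obtain ⟨r, rfl⟩ : ∃ r, m = r + 1 := ⟨m - 1, by omega⟩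
  clear hm
  have key : ∀ r : ℕ, (r + 1 : ℝ) * fixMean (r + 1) (fun N => (N : ℝ)) =
      r * fixMean r (fun N => (N : ℝ)) + 1 := by
    intro r
    rw [fixMean_succ]
    have : (fun N : ℕ => ((N + 1 : ℕ) : ℝ) + N * ((N - 1 : ℕ) : ℝ) + (r - N) * N) =
        fun N : ℕ => (r : ℝ) * N + 1 * 1 := by
      funext N
      rcases N with _ | N
      · simp
      · push_cast; simp; ring
    rw [this, fixMean_linear r _ _ (fun N => (N : ℝ)) (fun _ => 1), fixMean_const]; ring
  induction r with
  | zero => have := key 0; norm_num at this ⊢; exact this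
  | succ r ih =>
    have := key (r + 1)
    rw [ih] at this
    push_cast at this
    have h : (r + 1 + 1 : ℝ) ≠ 0 := by positivity
    exact mul_left_cancel₀ h (by linarith)

/-- The second moment of the number of fixed points. -/
theorem fixMean_sq {m : ℕ} (hm : 2 ≤ m) : fixMean m (fun N => (N : ℝ) ^ 2) = 2 := by
  obtain ⟨r, rfl⟩ : ∃ r, m = r + 2 := ⟨m - 2, by omega⟩
  clear hm
  have key : ∀ r : ℕ, 1 ≤ r → (r + 1 : ℝ) * fixMean (r + 1) (fun N => (N : ℝ) ^ 2) =
      (r - 1) * fixMean r (fun N => (N : ℝ) ^ 2) + 4 := by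
    intro r hr
    rw [fixMean_succ]
    have : (fun N : ℕ => ((N + 1 : ℕ) : ℝ) ^ 2 + N * ((N - 1 : ℕ) : ℝ) ^ 2 +
          (r - N) * (N : ℝ) ^ 2) =
        fun N : ℕ => (r - 1 : ℝ) * (N : ℝ) ^ 2 + 1 * (3 * (N : ℝ) + 1 * 1) := by
      funext N
      rcases N with _ | N
      · simp
      · push_cast; simp; ring
    rw [this, fixMean_linear r _ _ (fun N => (N : ℝ) ^ 2) (fun N => 3 * (N : ℝ) + 1 * 1),
      fixMean_linear r _ _ (fun N => (N : ℝ)) (fun _ => 1), fixMean_const, fixMean_id hr]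
    ring
  induction r with
  | zero => have := key 1 le_rfl; norm_num at this ⊢; linarith
  | succ r ih =>
    have := key (r + 2) (by omega)
    rw [ih] at this
    push_cast at this
    have h : (r + 2 + 1 : ℝ) ≠ 0 := by positivity
    exact mul_left_cancel₀ h (by linarith)

/-- Freezing one more point: the difference of the means over permutations of `m` and of `m + 1`
points in terms of the increments of `h`. -/
theorem fixMean_sub (m : ℕ) (h : ℕ → ℝ) :
    (m + 1 : ℝ) * (fixMean m (fun N => h (N + 1)) - fixMean (m + 1) h) =
      fixMean m (fun N => (m : ℝ) * (h (N + 1) - h N) + N * (h N - h (N - 1))) := by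
  rw [mul_sub, fixMean_succ]
  have := fixMean_linear m (m + 1) (-1) (fun N => h (N + 1))
    (fun N => h (N + 1) + N * h (N - 1) + (m - N) * h N)
  rw [neg_one_mul, ← sub_eq_add_neg] at this
  rw [← this]
  congr 1
  funext N
  ring

/-! ### The size chain -/

/-- One step of the chain of the number of values: from `j` values, a uniform permutation fixing
them has `j + N` fixed points, and a uniform word in these has a random number of values. -/
def sizeStep (n k : ℕ) (g : ℕ → ℝ) (j : ℕ) : ℝ :=
  fixMean (k - j) fun N => occMean (j + N) g n 0

/-- One more value: the increments of `sizeStep` in terms of increments in the number of boxes. -/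
theorem sizeStep_sub {n k j : ℕ} (hj : j < k) (g : ℕ → ℝ) :
    ((k - j : ℕ) : ℝ) * (sizeStep n k g (j + 1) - sizeStep n k g j) =
      fixMean (k - j - 1) (fun N =>
        ((k - j - 1 : ℕ) : ℝ) * (occMean (j + N + 1) g n 0 - occMean (j + N) g n 0) +
          N * (occMean (j + N) g n 0 - occMean (j + (N - 1)) g n 0)) := by
  obtain ⟨m, rfl⟩ : ∃ m, k = j + (m + 1) := ⟨k - j - 1, by omega⟩
  have h := fixMean_sub m fun N => occMean (j + N) g n 0
  have e1 : j + (m + 1) - j = m + 1 := by omega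
  have e2 : j + (m + 1) - (j + 1) = m := by omega
  simp only [sizeStep, e1, e2, Nat.add_sub_cancel, Nat.cast_add, Nat.cast_one]
  rw [show (fun N => occMean (j + 1 + N) g n 0) = fun N => occMean (j + (N + 1)) g n 0 from
    funext fun N => by rw [add_assoc, add_comm 1 N]]
  exact h

theorem abs_fixMean_le {m : ℕ} {g h : ℕ → ℝ} (H : ∀ N ≤ m, |g N| ≤ h N) :
    |fixMean m g| ≤ fixMean m h := by
  rw [abs_le]
  constructor
  · have := fixMean_mono (m := m) (g := fun N => (-1) * h N + 0 * h N) (h := g)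
      fun N hN => by linarith [(abs_le.1 (H N hN)).1]
    rw [fixMean_linear] at this
    linarith
  · exact fixMean_mono fun N hN => (abs_le.1 (H N hN)).2

/-- A potential `W` whose increments are multiplied by at most `ρ` by the size chain controls all
functions: `d` bounds the increments of the mean of `W` in the number of boxes. -/
theorem abs_sizeStep_sub_le {n k : ℕ} (hn : 1 ≤ n) (hnk : n ≤ k) {W d : ℕ → ℝ} {ρ : ℝ}
    (hd : ∀ f, 1 ≤ f → f < k → occMean (f + 1) W n 0 - occMean f W n 0 ≤ d f)
    (hρ : ∀ j, 1 ≤ j → j < n →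
      fixMean (k - j - 1) (fun N => ((k - j - 1 : ℕ) : ℝ) * d (j + N) + N * d (j + (N - 1))) ≤
        ((k - j : ℕ) : ℝ) * (ρ * (W (j + 1) - W j)))
    {g : ℕ → ℝ} {L : ℝ} (hL : 0 ≤ L)
    (hg : ∀ j, 1 ≤ j → j < n → |g (j + 1) - g j| ≤ L * (W (j + 1) - W j))
    (j : ℕ) (h1 : 1 ≤ j) (hj : j < n) :
    |sizeStep n k g (j + 1) - sizeStep n k g j| ≤ ρ * L * (W (j + 1) - W j) := by
  have hkj : (0 : ℝ) < ((k - j : ℕ) : ℝ) := by exact_mod_cast (by omega : 0 < k - j)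
  have hD : ∀ f, 1 ≤ f → f < k → |occMean (f + 1) g n 0 - occMean f g n 0| ≤ L * d f :=
    fun f hf hfk => (abs_occMean_sub_le hn hf hg).trans
      (mul_le_mul_of_nonneg_left (hd f hf hfk) hL)
  refine le_of_mul_le_mul_left ?_ hkj
  rw [← abs_of_pos hkj, ← abs_mul, abs_of_pos hkj, sizeStep_sub (by omega)]
  calc _ ≤ fixMean (k - j - 1) (fun N => L * (((k - j - 1 : ℕ) : ℝ) * d (j + N) +
          N * d (j + (N - 1))) + 0 * d N) := by
        refine abs_fixMean_le fun N hN => (abs_add_le _ _).trans ?_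
        rw [abs_mul, abs_mul, Nat.abs_cast, Nat.abs_cast]
        have e1 : ((k - j - 1 : ℕ) : ℝ) * |occMean (j + N + 1) g n 0 - occMean (j + N) g n 0| ≤
            ((k - j - 1 : ℕ) : ℝ) * (L * d (j + N)) := by
          rcases Nat.eq_zero_or_pos (k - j - 1) with h0 | h0
          · simp [h0]
          · exact mul_le_mul_of_nonneg_left (hD _ (by omega) (by omega)) (by positivity)
        have e2 : (N : ℝ) * |occMean (j + N) g n 0 - occMean (j + (N - 1)) g n 0| ≤
            N * (L * d (j + (N - 1))) := by
          rcases Nat.eq_zero_or_pos N with h0 | h0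
          · simp [h0]
          · have := hD (j + (N - 1)) (by omega) (by omega)
            rw [show j + (N - 1) + 1 = j + N by omega] at this
            exact mul_le_mul_of_nonneg_left this (by positivity)
        linarith
    _ = L * fixMean (k - j - 1) (fun N => ((k - j - 1 : ℕ) : ℝ) * d (j + N) +
          N * d (j + (N - 1))) := by rw [fixMean_linear]; ring
    _ ≤ L * (((k - j : ℕ) : ℝ) * (ρ * (W (j + 1) - W j))) :=
        mul_le_mul_of_nonneg_left (hρ j h1 hj) hL
    _ = _ := by ring

theorem abs_iterate_sizeStep_sub_le {n k : ℕ} (hn : 1 ≤ n) (hnk : n ≤ k) {W d : ℕ → ℝ} {ρ : ℝ}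
    (hρ0 : 0 ≤ ρ)
    (hd : ∀ f, 1 ≤ f → f < k → occMean (f + 1) W n 0 - occMean f W n 0 ≤ d f)
    (hρ : ∀ j, 1 ≤ j → j < n →
      fixMean (k - j - 1) (fun N => ((k - j - 1 : ℕ) : ℝ) * d (j + N) + N * d (j + (N - 1))) ≤
        ((k - j : ℕ) : ℝ) * (ρ * (W (j + 1) - W j)))
    {g : ℕ → ℝ} {L : ℝ} (hL : 0 ≤ L)
    (hg : ∀ j, 1 ≤ j → j < n → |g (j + 1) - g j| ≤ L * (W (j + 1) - W j)) (t : ℕ)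
    (j : ℕ) (h1 : 1 ≤ j) (hj : j < n) :
    |(sizeStep n k)^[t] g (j + 1) - (sizeStep n k)^[t] g j| ≤
      ρ ^ t * L * (W (j + 1) - W j) := by
  induction t generalizing j with
  | zero => simpa using hg j h1 hj
  | succ t ih =>
    rw [Function.iterate_succ_apply', pow_succ']
    have := abs_sizeStep_sub_le hn hnk hd hρ (mul_nonneg (pow_nonneg hρ0 t) hL) ih j h1 hj
    rwa [← mul_assoc] at this

theorem abs_sub_le_of_increments {n : ℕ} {g W : ℕ → ℝ} {L : ℝ}
    (hg : ∀ j, 1 ≤ j → j < n → |g (j + 1) - g j| ≤ L * (W (j + 1) - W j))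
    {i j : ℕ} (hi : 1 ≤ i) (hij : i ≤ j) (hj : j ≤ n) :
    |g j - g i| ≤ L * (W j - W i) := by
  induction j, hij using Nat.le_induction with
  | base => simp
  | succ j hij ih =>
    have h1 := ih (by omega)
    have h2 := hg j (by omega) (by omega)
    have h3 := abs_sub_le (g (j + 1)) (g j) (g i)
    linarith

theorem abs_iterate_sizeStep_sub_le_of_bounded {n k : ℕ} (hn : 1 ≤ n) (hnk : n ≤ k)
    {W d : ℕ → ℝ} {ρ L : ℝ} (hρ0 : 0 ≤ ρ) (hL : 0 ≤ L)
    (hd : ∀ f, 1 ≤ f → f < k → occMean (f + 1) W n 0 - occMean f W n 0 ≤ d f)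
    (hρ : ∀ j, 1 ≤ j → j < n →
      fixMean (k - j - 1) (fun N => ((k - j - 1 : ℕ) : ℝ) * d (j + N) + N * d (j + (N - 1))) ≤
        ((k - j : ℕ) : ℝ) * (ρ * (W (j + 1) - W j)))
    (hW : ∀ j, 1 ≤ j → j < n → 1 ≤ L * (W (j + 1) - W j))
    {g : ℕ → ℝ} (hg : ∀ j, 1 ≤ j → j ≤ n → 0 ≤ g j ∧ g j ≤ 1) (t : ℕ)
    {i j : ℕ} (hi : 1 ≤ i) (hij : i ≤ j) (hj : j ≤ n) :
    |(sizeStep n k)^[t] g j - (sizeStep n k)^[t] g i| ≤ ρ ^ t * L * (W n - W 1) := by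
  have hg' : ∀ j, 1 ≤ j → j < n → |g (j + 1) - g j| ≤ L * (W (j + 1) - W j) := by
    intro j h1 h2
    have a := hg j h1 h2.le
    have b := hg (j + 1) (by omega) h2
    refine le_trans ?_ (hW j h1 h2)
    rw [abs_le]; constructor <;> linarith
  have hinc := abs_iterate_sizeStep_sub_le hn hnk hρ0 hd hρ hL hg' t
  have hpos : 0 ≤ ρ ^ t * L := mul_nonneg (pow_nonneg hρ0 t) hL
  have m1 := (abs_nonneg _).trans (abs_sub_le_of_increments hinc le_rfl hi (hij.trans hj))
  have m2 := (abs_nonneg _).trans (abs_sub_le_of_increments hinc (hi.trans hij) hj le_rfl)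
  have := abs_sub_le_of_increments hinc hi hij hj
  linarith

/-! ### Increments of the mean of the potential -/

/-- A discrete version of the fact that `(1 + x) e⁻ˣ` decreases. -/
theorem one_add_div_mul_pow_antitone {p : ℕ} (hp : 1 ≤ p) :
    Antitone fun n : ℕ => (1 + n / p : ℝ) * (p / (p + 1)) ^ n := by
  have hp' : (0 : ℝ) < p := by exact_mod_cast hp
  refine antitone_nat_of_succ_le fun n => ?_
  rw [pow_succ']
  have : (1 + ((n + 1 : ℕ) : ℝ) / p) * (p / (p + 1)) ≤ 1 + n / p := by
    rw [← sub_nonneg]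
    have : (1 + n / p : ℝ) - (1 + ((n + 1 : ℕ) : ℝ) / p) * (p / (p + 1)) =
        n / (p * (p + 1)) := by
      push_cast; field_simp; ring
    rw [this]; positivity
  calc _ = (1 + ((n + 1 : ℕ) : ℝ) / p) * (p / (p + 1)) * (p / (p + 1)) ^ n := by ring
    _ ≤ _ := mul_le_mul_of_nonneg_right this (by positivity)

/-- `(p / (p + 1)) ^ p ≥ 1 / e ≥ 1 / 3`. -/
theorem third_le_pow {p : ℕ} (hp : 1 ≤ p) : (1 / 3 : ℝ) ≤ (p / (p + 1)) ^ p := by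
  have hp' : (0 : ℝ) < p := by exact_mod_cast hp
  have h : (1 + 1 / p : ℝ) ^ p ≤ 3 := by
    calc (1 + 1 / p : ℝ) ^ p ≤ Real.exp (1 / p) ^ p := by
          refine pow_le_pow_left₀ (by positivity) ?_ _
          linarith [Real.add_one_le_exp (1 / p : ℝ)]
      _ = Real.exp 1 := by rw [← Real.exp_nat_mul]; congr 1; field_simp
      _ ≤ 3 := by linarith [Real.exp_one_lt_d9]
  have e : (p : ℝ) / (p + 1) = (1 + 1 / (p : ℝ))⁻¹ := by field_simp
  rw [e, inv_pow, one_div]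
  exact inv_anti₀ (by positivity) h

theorem two_thirds_le {p n : ℕ} (hp : 1 ≤ p) (hn : n ≤ p) :
    (2 / 3 : ℝ) ≤ (1 + n / p) * (p / (p + 1)) ^ n := by
  have hp' : (0 : ℝ) < p := by exact_mod_cast hp
  refine le_trans ?_ (one_add_div_mul_pow_antitone hp hn)
  have := third_le_pow hp
  simp only [div_self hp'.ne']
  linarith

theorem third_le {p n : ℕ} (hp : 1 ≤ p) (hn : n ≤ 2 * p) :
    (1 / 3 : ℝ) ≤ (1 + n / p) * (p / (p + 1)) ^ n := by
  have hp' : (0 : ℝ) < p := by exact_mod_cast hp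
  refine le_trans ?_ (one_add_div_mul_pow_antitone hp hn)
  have := third_le_pow hp
  have e : ((2 * p : ℕ) : ℝ) / p = 2 := by push_cast; field_simp
  have e2 : ((p : ℝ) / (p + 1)) ^ (2 * p) = ((p / (p + 1)) ^ p) ^ 2 := by
    rw [← pow_mul, mul_comm]
  simp only [e, e2]
  nlinarith

/-- The quadratic potential with increments `M - j`. -/
def quadPot (M : ℝ) (j : ℕ) : ℝ := M * j - j * (j - 1) / 2

theorem quadPot_sub (M : ℝ) (j : ℕ) : quadPot M (j + 1) - quadPot M j = M - j := by
  simp only [quadPot]; push_cast; ring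

/-- The quadratic potential is a combination of `1`, the number of empty boxes and the number of
ordered pairs of empty boxes. -/
theorem occMean_quadPot {f : ℕ} (hf : f ≠ 0) (M : ℝ) (n : ℕ) :
    occMean f (quadPot M) n 0 = quadPot M f - (M - f + 1) * ((1 - 1 / f : ℝ) ^ n * f) -
      (1 - 2 / f : ℝ) ^ n * (f * (f - 1)) / 2 := by
  have e : quadPot M = fun j : ℕ => (-1 / 2) * (((f : ℝ) - j) * (f - j - 1)) +
      1 * (-(M - f + 1) * ((f : ℝ) - j) + quadPot M f * 1) := by
    funext j; simp only [quadPot]; ring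
  have h1 := occMean_linear f (-1 / 2) 1 (fun j => ((f : ℝ) - j) * (f - j - 1))
    (fun j => -(M - f + 1) * ((f : ℝ) - j) + quadPot M f * 1) n 0
  have h2 := occMean_linear f (-(M - f + 1)) (quadPot M f) (fun j => (f : ℝ) - j)
    (fun _ => 1) n 0
  rw [h2, occMean_empty_pairs hf, occMean_empty hf, occMean_const] at h1
  conv_lhs => rw [e]
  rw [h1]
  simp; ring

/-- The exact increment: `M - f` minus a term that is shown to be nonnegative below. -/
theorem occMean_quadPot_sub {f : ℕ} (hf : f ≠ 0) (M : ℝ) (n : ℕ) :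
    occMean (f + 1) (quadPot M) n 0 - occMean f (quadPot M) n 0 =
      M - f - ((M - f) * ((1 - 1 / (f + 1) : ℝ) ^ n * (f + 1) - (1 - 1 / f : ℝ) ^ n * f) -
        (1 - 1 / f : ℝ) ^ n * f +
        ((1 - 2 / (f + 1) : ℝ) ^ n * ((f + 1) * f) -
          (1 - 2 / f : ℝ) ^ n * (f * (f - 1))) / 2) := by
  rw [occMean_quadPot hf, occMean_quadPot (Nat.succ_ne_zero f), ← sub_eq_zero]
  have := quadPot_sub M f
  push_cast
  linear_combination this

/-- Throwing the balls does not increase the potential difference: with one box more, the mean of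
`quadPot M` grows by at most `M - f`, the increment of `quadPot M` at `f` itself. With `a` the
probability that a given box stays empty and `λ = n / f`, the difference of the two sides is about
`a f ((M / f - 1) (1 + λ) + (1 + λ) exp (-λ) - 1)`. -/
theorem occMean_quadPot_sub_le {f n : ℕ} (hf : 1 ≤ f) (hn : 2 ≤ n) {M : ℝ}
    (hMn : 4 * (n : ℝ) / 3 ≤ M) (hMf : 4 * (f + 1 : ℝ) / 3 ≤ M) :
    occMean (f + 1) (quadPot M) n 0 - occMean f (quadPot M) n 0 ≤ M - f := by
  rw [occMean_quadPot_sub (by omega)]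
  have hn' : (2 : ℝ) ≤ n := by exact_mod_cast hn
  have hn0 : n ≠ 0 := by omega
  have hf' : (1 : ℝ) ≤ f := by exact_mod_cast hf
  rcases (show f = 1 ∨ f = 2 ∨ 3 ≤ f by omega) with rfl | rfl | hf3
  · have h1 : (0 : ℝ) < (1 / 2) ^ n := by positivity
    norm_num at hMf ⊢
    rw [zero_pow hn0]
    nlinarith
  · have h1 : (2 / 3 : ℝ) ^ n = (1 / 2) ^ n * (4 / 3) ^ n := by
      rw [← mul_pow]; norm_num
    have h3 := one_add_mul_le_pow (a := (1 / 3 : ℝ)) (by norm_num) n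
    have h2 : (0 : ℝ) < (1 / 2) ^ n := by positivity
    have h4 : (0 : ℝ) ≤ (1 / 3) ^ n * 6 / 2 := by positivity
    norm_num at hMf h3 h4 ⊢
    rw [zero_pow hn0, h1]
    have h5 : (1 / 2 : ℝ) ^ n * (5 / 3) ≤ (1 / 2) ^ n * (4 / 3) ^ n :=
      mul_le_mul_of_nonneg_left (by linarith) h2.le
    have h6 : 0 ≤ (M - 2) * ((1 / 2 : ℝ) ^ n * (4 / 3) ^ n * 3 - (1 / 2) ^ n * 2) -
        (1 / 2) ^ n * 2 := by
      have : 2 ≤ M - 2 := by linarith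
      nlinarith
    linarith
  · obtain ⟨p, rfl⟩ : ∃ p, f = p + 2 := ⟨f - 2, by omega⟩
    have hp : 1 ≤ p := by omega
    have hp' : (1 : ℝ) ≤ p := by exact_mod_cast hp
    have e1 : ((p + 2 : ℕ) : ℝ) = p + 2 := by push_cast; ring
    rw [e1] at hMf ⊢
    -- `a` is the probability that a given box stays empty, and `a c` the one for a pair of boxes.
    set a : ℝ := (1 - 1 / (p + 2 : ℝ)) ^ n with ha
    set c : ℝ := (p / (p + 1)) ^ n with hc
    have ha0 : 0 < a := by
      apply pow_pos
      rw [sub_pos, div_lt_one (by positivity)]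
      linarith
    have hc0 : 0 < c := by positivity
    have hb : (1 - 2 / (p + 2 : ℝ)) ^ n = a * c := by
      rw [ha, hc, ← mul_pow]; congr 1; field_simp; ring
    have ha' : a * (1 + n * (1 / ((p + 1) * (p + 3)))) ≤
        (1 - 1 / ((p + 2 : ℝ) + 1)) ^ n := by
      have : (1 - 1 / ((p + 2 : ℝ) + 1)) ^ n = a * (1 + 1 / ((p + 1) * (p + 3))) ^ n := by
        rw [ha, ← mul_pow]; congr 1; field_simp; ring
      rw [this]
      refine mul_le_mul_of_nonneg_left (one_add_mul_le_pow ?_ n) ha0.le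
      have : (0 : ℝ) ≤ 1 / ((p + 1) * (p + 3)) := by positivity
      linarith
    have hb' : a * c * (1 + n * (2 / (p * (p + 3)))) ≤
        (1 - 2 / ((p + 2 : ℝ) + 1)) ^ n := by
      have : (1 - 2 / ((p + 2 : ℝ) + 1)) ^ n = a * c * (1 + 2 / (p * (p + 3))) ^ n := by
        rw [ha, hc, ← mul_pow, ← mul_pow]; congr 1; field_simp; ring
      rw [this]
      refine mul_le_mul_of_nonneg_left (one_add_mul_le_pow ?_ n) (by positivity)
      have : (0 : ℝ) ≤ 2 / (p * (p + 3)) := by positivity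
      linarith
    rw [hb]
    have hMf0 : 0 ≤ M - (p + 2) := by linarith
    have s1 : a * ((p + n + 1) / (p + 1)) ≤
        (1 - 1 / ((p + 2 : ℝ) + 1)) ^ n * (p + 2 + 1) - a * (p + 2) := by
      have := mul_le_mul_of_nonneg_right ha' (by linarith : (0 : ℝ) ≤ p + 2 + 1)
      have e : a * (1 + n * (1 / ((p + 1) * (p + 3)))) * (p + 2 + 1) =
          a * ((p + n + 1) / (p + 1)) + a * (p + 2) := by field_simp; ring
      linarith
    have s2 : a * (p + 2) * ((1 + n / p) * c) ≤
        ((1 - 2 / ((p + 2 : ℝ) + 1)) ^ n * ((p + 2 + 1) * (p + 2)) -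
          a * c * ((p + 2) * (p + 2 - 1))) / 2 := by
      have := mul_le_mul_of_nonneg_right hb' (by positivity : (0 : ℝ) ≤ (p + 2 + 1) * (p + 2))
      have e : a * c * (1 + n * (2 / (p * (p + 3)))) * ((p + 2 + 1) * (p + 2)) =
          2 * (a * (p + 2) * ((1 + n / p) * c)) + a * c * ((p + 2) * (p + 2 - 1)) := by
        field_simp; ring
      linarith
    have s3 : (M - (p + 2)) * (a * ((p + n + 1) / (p + 1))) ≤ (M - (p + 2)) *
        ((1 - 1 / ((p + 2 : ℝ) + 1)) ^ n * (p + 2 + 1) - a * (p + 2)) :=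
      mul_le_mul_of_nonneg_left s1 hMf0
    -- The first term suffices if there are many balls, and the second term covers `2 / 3` or
    -- `1 / 3` of the bound otherwise.
    have main : 1 ≤ (M - (p + 2)) * (p + n + 1) / ((p + 1) * (p + 2)) + (1 + n / p) * c := by
      have hb1 : (p + 6 : ℝ) / 3 ≤ M - (p + 2) := by linarith
      have hc1 : 0 ≤ (1 + n / p) * c := by positivity
      rcases (show n ≤ p ∨ (p + 1 ≤ n ∧ n ≤ 2 * p) ∨ 2 * p + 1 ≤ n by omega) with h | ⟨h, h'⟩ | h
      · have h1 := two_thirds_le hp h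
        have h2 : (1 / 3 : ℝ) ≤ (M - (p + 2)) * (p + n + 1) / ((p + 1) * (p + 2)) := by
          rw [le_div_iff₀ (by positivity)]
          nlinarith
        linarith
      · have h1 := third_le hp h'
        have hh : (p + 1 : ℝ) ≤ n := by exact_mod_cast h
        have h2 : (2 / 3 : ℝ) ≤ (M - (p + 2)) * (p + n + 1) / ((p + 1) * (p + 2)) := by
          rw [le_div_iff₀ (by positivity)]
          nlinarith
        linarith
      · have hh : (2 * p + 1 : ℝ) ≤ n := by exact_mod_cast h
        have h2 : (1 : ℝ) ≤ (M - (p + 2)) * (p + n + 1) / ((p + 1) * (p + 2)) := by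
          rw [le_div_iff₀ (by positivity)]
          nlinarith
        linarith
    have s4 := mul_le_mul_of_nonneg_left main (by positivity : 0 ≤ a * (p + 2))
    have e4 : a * (p + 2) * ((M - (p + 2)) * (p + n + 1) / ((p + 1) * (p + 2)) +
        (1 + n / p) * c) = (M - (p + 2)) * (a * ((p + n + 1) / (p + 1))) +
        a * (p + 2) * ((1 + n / p) * c) := by field_simp
    linarith

/-! ### Contraction of the size chain -/

theorem fixMean_zero (g : ℕ → ℝ) : fixMean 0 g = g 0 := by
  simp [fixMean, fixedPts]

theorem fixMean_one (g : ℕ → ℝ) : fixMean 1 g = g 1 := by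
  simp [fixMean, fixedPts]

theorem fixMean_increments_quad {m j : ℕ} (hm : 2 ≤ m) (M : ℝ) :
    fixMean m (fun N => (m : ℝ) * (M - (j + N)) + N * (M - (j + N) + 1)) =
      (m + 1) * (M - j - 1) := by
  have e : (fun N : ℕ => (m : ℝ) * (M - (j + N)) + N * (M - (j + N) + 1)) =
      fun N : ℕ => (-1) * (N : ℝ) ^ 2 + 1 * ((M - j + 1 - m) * N + m * (M - j) * 1) := by
    funext N; ring
  rw [e, fixMean_linear m (-1) 1 (fun N => (N : ℝ) ^ 2)
    (fun N => (M - j + 1 - m) * N + m * (M - j) * 1), fixMean_sq hm,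
    fixMean_linear m _ _ (fun N => (N : ℝ)) (fun _ => 1), fixMean_id (by omega), fixMean_const]
  ring

/-- A bound for the increments of the mean of `quadPot (4 k / 3)` in the number of boxes. The
improvement by `1 / 4` for the largest number of boxes is needed for `k ≤ 5` only. -/
def quadIncr (k f : ℕ) : ℝ :=
  4 * (k : ℝ) / 3 - f - if k ≤ 5 ∧ f + 1 = k then 1 / 4 else 0

theorem quadIncr_le (k f : ℕ) : quadIncr k f ≤ 4 * (k : ℝ) / 3 - f := by
  unfold quadIncr; split_ifs <;> linarith

theorem occMean_quadPot_sub_le_quadIncr {n k : ℕ} (hn : 4 ≤ n) (hnk : n ≤ k) (f : ℕ)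
    (hf : 1 ≤ f) (hfk : f < k) :
    occMean (f + 1) (quadPot (4 * (k : ℝ) / 3)) n 0 - occMean f (quadPot (4 * (k : ℝ) / 3)) n 0 ≤
      quadIncr k f := by
  unfold quadIncr
  split_ifs with h
  · obtain ⟨h5, rfl⟩ := h
    rw [occMean_quadPot_sub (by omega)]
    rcases (show f = 3 ∧ n = 4 ∨ f = 4 ∧ n = 4 ∨ f = 4 ∧ n = 5 by omega) with
      ⟨rfl, rfl⟩ | ⟨rfl, rfl⟩ | ⟨rfl, rfl⟩ <;> norm_num
  · have h1 : (n : ℝ) ≤ k := by exact_mod_cast hnk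
    have h2 : (f + 1 : ℝ) ≤ k := by exact_mod_cast hfk
    rw [sub_zero]
    exact occMean_quadPot_sub_le hf (by omega) (by linarith) (by linarith)

/-- If `k - j - 1 ≥ 2`, the permutation lowers `M - j` by `1`, which is at least the fraction
`3 / (4 k)` of it since `M = 4 k / 3`. -/
theorem fixMean_quadIncr_le {n k : ℕ} (hn : 4 ≤ n) (hnk : n ≤ k) (j : ℕ) (hj : 1 ≤ j)
    (hjn : j < n) :
    fixMean (k - j - 1) (fun N => ((k - j - 1 : ℕ) : ℝ) * quadIncr k (j + N) +
        N * quadIncr k (j + (N - 1))) ≤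
      ((k - j : ℕ) : ℝ) * ((1 - 3 / (4 * k)) *
        (quadPot (4 * (k : ℝ) / 3) (j + 1) - quadPot (4 * (k : ℝ) / 3) j)) := by
  rw [quadPot_sub]
  have hk : (4 : ℝ) ≤ k := by exact_mod_cast hn.trans hnk
  have hj' : (1 : ℝ) ≤ j := by exact_mod_cast hj
  have hjk : (j + 1 : ℝ) ≤ k := by exact_mod_cast (by omega : j + 1 ≤ k)
  have hρ : (0 : ℝ) ≤ 1 - 3 / (4 * k) := by
    rw [sub_nonneg, div_le_one (by positivity)]; linarith
  rcases (show k - j - 1 = 0 ∨ k - j - 1 = 1 ∨ 2 ≤ k - j - 1 by omega) with h | h | h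
  · rw [h, fixMean_zero]
    simp only [Nat.cast_zero, zero_mul, add_zero]
    exact mul_nonneg (by positivity) (mul_nonneg hρ (by linarith))
  -- A permutation of one point has one fixed point, so the second moment is `1` and not `2`; this
  -- is where the improvement in `quadIncr` for small `k` is used.
  · rw [h, fixMean_one, show k - j = 2 by omega]
    obtain rfl : k = j + 2 := by omega
    have e1 := quadIncr_le (j + 2) j
    push_cast at hk e1 ⊢
    have e2 : quadIncr (j + 2) (j + 1) ≤ 4 * (j + 2 : ℝ) / 3 - (j + 1) -
        if j ≤ 3 then 1 / 4 else 0 := by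
      unfold quadIncr; push_cast; split_ifs <;> first | omega | linarith
    have e3 : (1 - 3 / (4 * (j + 2 : ℝ))) * (4 * (j + 2 : ℝ) / 3 - j) =
        4 * (j + 2 : ℝ) / 3 - j - 1 / 4 - 3 / (2 * (j + 2)) := by
      field_simp; ring
    rw [e3]
    simp only [add_zero, one_mul]
    split_ifs at e2 with h3
    · have : 3 / (2 * (j + 2 : ℝ)) ≤ 3 / 8 := by
        rw [div_le_div_iff₀ (by positivity) (by norm_num)]; linarith
      linarith
    · have h4 : (4 : ℝ) ≤ j := by exact_mod_cast (by omega : 4 ≤ j)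
      have : 3 / (2 * (j + 2 : ℝ)) ≤ 1 / 4 := by
        rw [div_le_div_iff₀ (by positivity) (by norm_num)]; linarith
      linarith
  · have hm : ((k - j : ℕ) : ℝ) = ((k - j - 1 : ℕ) : ℝ) + 1 := by
      rw [show k - j = k - j - 1 + 1 by omega]; push_cast; simp
    rw [hm]
    refine (fixMean_mono (h := fun N => ((k - j - 1 : ℕ) : ℝ) * (4 * (k : ℝ) / 3 - (j + N)) +
      N * (4 * (k : ℝ) / 3 - (j + N) + 1)) fun N _ => ?_).trans ?_
    · refine add_le_add (mul_le_mul_of_nonneg_left ?_ (by positivity)) ?_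
      · have := quadIncr_le k (j + N); push_cast at this; exact this
      · rcases N with _ | N
        · simp
        · refine mul_le_mul_of_nonneg_left ?_ (by positivity)
          have := quadIncr_le k (j + N); push_cast at this ⊢; simp; linarith
    · rw [fixMean_increments_quad h]
      refine mul_le_mul_of_nonneg_left ?_ (by positivity)
      have : 3 / (4 * k) * (4 * (k : ℝ) / 3 - j) ≤ 1 := by
        rw [div_mul_eq_mul_div, div_le_one (by positivity)]; linarith
      linarith

theorem occMean_id {f : ℕ} (hf : f ≠ 0) (n : ℕ) :
    occMean f (fun j => (j : ℝ)) n 0 = f - (1 - 1 / f : ℝ) ^ n * f := by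
  have h := occMean_linear f (-1) f (fun j => (f : ℝ) - j) (fun _ => 1) n 0
  rw [occMean_empty hf, occMean_const] at h
  rw [show (fun j : ℕ => (j : ℝ)) = fun j : ℕ => -1 * ((f : ℝ) - j) + f * 1 from
    funext fun j => by ring, h]
  simp; ring

theorem occMean_id_sub_two (f : ℕ) (hf : 1 ≤ f) :
    occMean (f + 1) (fun j => (j : ℝ)) 2 0 - occMean f (fun j => (j : ℝ)) 2 0 ≤ 1 / 2 := by
  have hf' : (1 : ℝ) ≤ f := by exact_mod_cast hf
  rw [occMean_id (by omega), occMean_id (by omega)]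
  push_cast
  have e : (f + 1 - (1 - 1 / (f + 1 : ℝ)) ^ 2 * (f + 1) - (f - (1 - 1 / f : ℝ) ^ 2 * f)) =
      1 / (f * (f + 1)) := by field_simp; ring
  rw [e, div_le_div_iff₀ (by positivity) (by norm_num)]
  nlinarith

theorem occMean_id_sub_three (f : ℕ) (hf : 1 ≤ f) :
    occMean (f + 1) (fun j => (j : ℝ)) 3 0 - occMean f (fun j => (j : ℝ)) 3 0 ≤ 3 / 4 := by
  have hf' : (1 : ℝ) ≤ f := by exact_mod_cast hf
  rw [occMean_id (by omega), occMean_id (by omega)]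
  push_cast
  have e : (f + 1 - (1 - 1 / (f + 1 : ℝ)) ^ 3 * (f + 1) - (f - (1 - 1 / f : ℝ) ^ 3 * f)) =
      (3 * (f * (f + 1)) - (2 * f + 1)) / (f * (f + 1)) ^ 2 := by field_simp; ring
  rw [e, div_le_div_iff₀ (by positivity) (by norm_num)]
  nlinarith [mul_nonneg (sub_nonneg.2 hf') (sub_nonneg.2 hf'),
    mul_nonneg (mul_nonneg (sub_nonneg.2 hf') (sub_nonneg.2 hf')) (sub_nonneg.2 hf'),
    mul_nonneg (mul_nonneg (sub_nonneg.2 hf') (sub_nonneg.2 hf'))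
      (mul_nonneg (sub_nonneg.2 hf') (sub_nonneg.2 hf'))]

theorem fixMean_const_incr_le (m : ℕ) {c : ℝ} (hc : 0 ≤ c) :
    fixMean m (fun N => (m : ℝ) * c + N * c) ≤ (m + 1 : ℝ) * c := by
  rcases Nat.eq_zero_or_pos m with rfl | hm
  · simp [fixMean_zero, hc]
  · have h := fixMean_linear m c (m * c) (fun N => (N : ℝ)) (fun _ => 1)
    rw [fixMean_id hm, fixMean_const] at h
    rw [show (fun N : ℕ => (m : ℝ) * c + N * c) = fun N : ℕ => c * (N : ℝ) + m * c * 1 from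
      funext fun N => by ring, h]
    linarith

/-- Contraction for the potential `j`, used for words of length two and three. -/
theorem sizeStep_contraction_linear {n k : ℕ} (hn : 1 ≤ n) (hnk : n ≤ k) {c : ℝ} (hc : 0 ≤ c)
    (hd : ∀ f, 1 ≤ f →
      occMean (f + 1) (fun j => (j : ℝ)) n 0 - occMean f (fun j => (j : ℝ)) n 0 ≤ c)
    {g : ℕ → ℝ} (hg : ∀ j, 1 ≤ j → j ≤ n → 0 ≤ g j ∧ g j ≤ 1) (t : ℕ)
    {i j : ℕ} (hi : 1 ≤ i) (hij : i ≤ j) (hj : j ≤ n) :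
    |(sizeStep n k)^[t] g j - (sizeStep n k)^[t] g i| ≤ c ^ t * (n - 1) := by
  have := abs_iterate_sizeStep_sub_le_of_bounded (W := fun j => (j : ℝ)) (d := fun _ => c)
    (L := 1) hn hnk hc zero_le_one (fun f hf _ => hd f hf)
    (fun j h1 h2 => ?_) (fun j _ _ => by push_cast; linarith) hg t hi hij hj
  · simpa using this
  · refine (fixMean_const_incr_le (k - j - 1) hc).trans_eq ?_
    rw [show k - j = k - j - 1 + 1 by omega]
    push_cast; simp

theorem one_sub_le_sq {k : ℕ} (hk : 1 ≤ k) : 1 - 1 / (k : ℝ) ≤ (1 - 1 / (2 * k)) ^ 2 := by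
  have : (1 - 1 / (2 * k : ℝ)) ^ 2 = 1 - 1 / k + (1 / (2 * k)) ^ 2 := by field_simp; ring
  rw [this]; nlinarith [sq_nonneg (1 / (2 * k : ℝ))]

theorem sq_le_cube {k : ℕ} (hk : 1 ≤ k) :
    (1 - 3 / (4 * (k : ℝ))) ^ 2 ≤ (1 - 1 / (2 * k)) ^ 3 := by
  have hk' : (1 : ℝ) ≤ k := by exact_mod_cast hk
  have : (1 - 1 / (2 * k : ℝ)) ^ 3 - (1 - 3 / (4 * (k : ℝ))) ^ 2 =
      (3 * k - 2) / (16 * k ^ 3) := by field_simp; ring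
  have h2 : 0 ≤ (3 * k - 2) / (16 * k ^ 3 : ℝ) := div_nonneg (by linarith) (by positivity)
  linarith

/-- If `q ≤ 1 / n`, a factor `r` with `r² n ≤ (n - 1)²` is absorbed by the excess of the rate
`q ^ (3 / 2)` over `q`. -/
theorem mul_le_of_sq_le_cube {x q r n : ℝ} (hn : 1 < n) (hq : 0 ≤ q)
    (hnq : n * q ≤ 1) (hxq : x ^ 2 ≤ q ^ 3) (hrn : r ^ 2 * n ≤ (n - 1) ^ 2) :
    r * x ≤ (n - 1) / n * q := by
  refine le_of_abs_le (abs_le_of_sq_le_sq ?_ (by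
    exact mul_nonneg (div_nonneg (by linarith) (by linarith)) hq))
  have hn0 : 0 < n := by linarith
  calc (r * x) ^ 2 = r ^ 2 * x ^ 2 := by ring
    _ ≤ r ^ 2 * q ^ 3 := mul_le_mul_of_nonneg_left hxq (sq_nonneg r)
    _ = (r ^ 2 * n) * (n * q) * (q / n) ^ 2 := by field_simp
    _ ≤ (n - 1) ^ 2 * 1 * (q / n) ^ 2 := by gcongr
    _ = _ := by ring

/-- The size chain forgets its starting point: as soon as `n (1 - 1 / (2 k)) ^ t ≤ 1`, the
difference of the means at two sizes is at most `(n - 1)² / n · (1 - 1 / (2 k)) ^ t`. -/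
theorem sizeStep_contraction {n k : ℕ} (hn : 2 ≤ n) (hnk : n ≤ k) (t : ℕ)
    (hq : (n : ℝ) * (1 - 1 / (2 * k)) ^ t ≤ 1)
    {g : ℕ → ℝ} (hg : ∀ j, 1 ≤ j → j ≤ n → 0 ≤ g j ∧ g j ≤ 1)
    {i j : ℕ} (hi : 1 ≤ i) (hij : i ≤ j) (hj : j ≤ n) :
    |(sizeStep n k)^[t] g j - (sizeStep n k)^[t] g i| ≤
      (n - 1) * ((n - 1) / n * (1 - 1 / (2 * k)) ^ t) := by
  have hk2 : (2 : ℝ) ≤ k := by exact_mod_cast hn.trans hnk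
  have hn2 : (2 : ℝ) ≤ n := by exact_mod_cast hn
  have hnk' : (n : ℝ) ≤ k := by exact_mod_cast hnk
  have hq0 : (0 : ℝ) ≤ 1 - 1 / (2 * k) := by
    rw [sub_nonneg, div_le_one (by positivity)]; linarith
  have hqt := pow_nonneg hq0 t
  have hρ0 : (0 : ℝ) ≤ 1 - 3 / (4 * k) := by
    rw [sub_nonneg, div_le_one (by positivity)]; linarith
  have hcube : ((1 - 3 / (4 * (k : ℝ))) ^ t) ^ 2 ≤ ((1 - 1 / (2 * k : ℝ)) ^ t) ^ 3 := by
    rw [← pow_mul, ← pow_mul, mul_comm t 2, mul_comm t 3, pow_mul, pow_mul]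
    exact pow_le_pow_left₀ (sq_nonneg _) (sq_le_cube (by omega)) t
  rcases (show n = 2 ∨ n = 3 ∨ 4 ≤ n by omega) with rfl | rfl | hn4
  · have h := sizeStep_contraction_linear (c := 1 / 2) (by omega) hnk (by norm_num)
      occMean_id_sub_two hg t hi hij hj
    have h2 : (1 / 2 : ℝ) ^ t ≤ (1 - 1 / (2 * k)) ^ t * (1 - 1 / (2 * k)) ^ t := by
      rw [← mul_pow]
      refine pow_le_pow_left₀ (by norm_num) ?_ t
      rw [← sq]
      refine le_trans ?_ (one_sub_le_sq (by omega))
      have : 1 / (k : ℝ) ≤ 1 / 2 := one_div_le_one_div_of_le (by norm_num) hk2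
      linarith
    push_cast at *
    nlinarith
  · have h := sizeStep_contraction_linear (c := 3 / 4) (by omega) hnk (by norm_num)
      occMean_id_sub_three hg t hi hij hj
    have hρ : (3 / 4 : ℝ) ≤ 1 - 3 / (4 * k) := by
      have : 3 / (4 * (k : ℝ)) ≤ 1 / 4 := by
        rw [div_le_div_iff₀ (by positivity) (by norm_num)]; push_cast at hnk'; linarith
      linarith
    have h2 : (3 / 4 : ℝ) ^ t ≤ (1 - 3 / (4 * k)) ^ t := pow_le_pow_left₀ (by norm_num) hρ t
    have h3 := mul_le_of_sq_le_cube (r := 1) (n := 3) (by norm_num) hqt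
      (by exact_mod_cast hq) hcube (by norm_num)
    push_cast at *
    linarith
  -- For longer words the potential is `quadPot (4 k / 3)`; `r` is the ratio of its mean increment
  -- to its least increment `M - n + 1`.
  · have hn4' : (4 : ℝ) ≤ n := by exact_mod_cast hn4
    set M : ℝ := 4 * (k : ℝ) / 3 with hM
    have hMn : 0 < M - n + 1 := by rw [hM]; linarith
    have h := abs_iterate_sizeStep_sub_le_of_bounded (L := 1 / (M - n + 1)) (by omega) hnk hρ0
      (by positivity) (occMean_quadPot_sub_le_quadIncr hn4 hnk) (fixMean_quadIncr_le hn4 hnk)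
      (fun j _ h2 => by
        rw [quadPot_sub, one_div, inv_mul_eq_div, one_le_div hMn]
        have : (j + 1 : ℝ) ≤ n := by exact_mod_cast h2
        linarith) hg t hi hij hj
    refine h.trans ?_
    have hr0 : 0 ≤ (M - n / 2) / (M - n + 1) := div_nonneg (by rw [hM]; linarith) hMn.le
    have hr : (M - n / 2) / (M - n + 1) ≤ 5 * n / (2 * n + 6) := by
      rw [div_le_div_iff₀ hMn (by positivity), hM]
      nlinarith
    have hrn : ((M - n / 2) / (M - n + 1)) ^ 2 * n ≤ ((n : ℝ) - 1) ^ 2 := by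
      calc _ ≤ (5 * n / (2 * n + 6) : ℝ) ^ 2 * n := by gcongr
        _ ≤ _ := by
          rw [div_pow, div_mul_eq_mul_div, div_le_iff₀ (by positivity)]
          obtain ⟨u, rfl⟩ : ∃ u : ℕ, n = u + 4 := ⟨n - 4, by omega⟩
          push_cast
          have hu : (0 : ℝ) ≤ u := by positivity
          nlinarith [pow_nonneg hu 2, pow_nonneg hu 3, pow_nonneg hu 4]
    have h3 := mul_le_of_sq_le_cube (by linarith) hqt hq hcube hrn
    calc _ = ((n : ℝ) - 1) * ((M - n / 2) / (M - n + 1) * (1 - 3 / (4 * k)) ^ t) := by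
          rw [← hM]; simp only [quadPot]; push_cast; field_simp; ring
      _ ≤ _ := mul_le_mul_of_nonneg_left h3 (by linarith)

/-! ### Random words -/

section Words

variable {α : Type*} [DecidableEq α]

/-- The mean of `Φ` at the set of values of a uniform word of length `n` in the alphabet `F`
(`0` if `F` is empty and `1 ≤ n`). -/
def wordMean (n : ℕ) (Φ : Finset α → ℝ) (F : Finset α) : ℝ :=
  (∑ x ∈ Fintype.piFinset fun _ : Fin n => F, Φ (univ.image x)) / (#F : ℝ) ^ n

theorem abs_wordMean_sub_le {Φ Ψ : Finset α → ℝ} {F : Finset α} {s : ℝ} (n : ℕ) (hs : 0 ≤ s)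
    (h : ∀ V, |Φ V - Ψ V| ≤ s) : |wordMean n Φ F - wordMean n Ψ F| ≤ s := by
  rw [wordMean, wordMean, ← sub_div, ← sum_sub_distrib, abs_div,
    abs_of_nonneg (by positivity : (0 : ℝ) ≤ (#F : ℝ) ^ n)]
  refine div_le_of_le_mul₀ (by positivity) hs ?_
  refine (abs_sum_le_sum_abs _ _).trans ((sum_le_sum fun x _ => h _).trans_eq ?_)
  simp [mul_comm]

theorem wordMean_mem_Icc {Φ : Finset α → ℝ} (h : ∀ V, Φ V ∈ Set.Icc (0 : ℝ) 1) (n : ℕ)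
    (F : Finset α) : wordMean n Φ F ∈ Set.Icc (0 : ℝ) 1 := by
  refine ⟨div_nonneg (sum_nonneg fun σ _ => (h _).1) (by positivity), ?_⟩
  refine div_le_one_of_le₀ ?_ (by positivity)
  exact (sum_le_sum fun σ _ => (h _).2).trans_eq (by simp)

theorem wordMean_image (n : ℕ) (Φ : Finset α → ℝ) (τ : Equiv.Perm α) (F : Finset α) :
    wordMean n Φ (F.image τ) = wordMean n (fun V => Φ (V.image τ)) F := by
  rw [wordMean, wordMean, card_image_of_injective _ τ.injective]
  congr 1
  refine (sum_equiv (Equiv.arrowCongr (Equiv.refl (Fin n)) τ) ?_ ?_).symm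
  · intro x; simp
  · intro x _; rw [image_image]; rfl

/-- The letters of a uniform word are balls thrown into the boxes `F`. -/
theorem sum_words_union_eq_occMean {F : Finset α} (hF : F.Nonempty) (g : ℕ → ℝ) (n : ℕ)
    (A : Finset α) (hA : A ⊆ F) :
    ∑ x ∈ Fintype.piFinset fun _ : Fin n => F, g #(A ∪ univ.image x) =
      (#F : ℝ) ^ n * occMean #F g n #A := by
  have hF0 : (#F : ℝ) ≠ 0 := by exact_mod_cast hF.card_pos.ne'
  induction n generalizing A with
  | zero => simp [occMean]
  | succ r ih =>
    have hsplit : ∑ x ∈ Fintype.piFinset fun _ : Fin (r + 1) => F, g #(A ∪ univ.image x) =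
        ∑ a ∈ F, ∑ x ∈ Fintype.piFinset fun _ : Fin r => F, g #(insert a A ∪ univ.image x) := by
      rw [← sum_product']
      refine (sum_equiv (Fin.consEquiv fun _ : Fin (r + 1) => α) ?_ ?_).symm
      · rintro ⟨a, x⟩; simp [Fin.forall_fin_succ]
      · rintro ⟨a, x⟩ _
        congr 2
        ext b
        simp [Fin.exists_fin_succ, eq_comm]
        tauto
    rw [hsplit, ← sum_sdiff hA]
    rw [sum_congr (g := fun _ => (#F : ℝ) ^ r * occMean #F g r (#A + 1)) rfl fun a ha => by
        rw [ih _ (insert_subset (mem_sdiff.1 ha).1 hA), card_insert_of_notMem (mem_sdiff.1 ha).2]]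
    rw [sum_congr (s₁ := A) (g := fun _ => (#F : ℝ) ^ r * occMean #F g r #A) rfl fun a ha => by
        rw [insert_eq_of_mem ha, ih _ hA]]
    rw [sum_const, sum_const, nsmul_eq_mul, nsmul_eq_mul, card_sdiff_of_subset hA,
      Nat.cast_sub (card_le_card hA), occMean, pow_succ]
    field_simp
    ring

theorem wordMean_eq_occMean {n : ℕ} (hn : 1 ≤ n) {Φ : Finset α → ℝ} {g : ℕ → ℝ}
    (h : ∀ V : Finset α, V.Nonempty → Φ V = g #V) {F : Finset α} (hF : F.Nonempty) :
    wordMean n Φ F = occMean #F g n 0 := by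
  have hF0 : (#F : ℝ) ^ n ≠ 0 := pow_ne_zero _ (by exact_mod_cast hF.card_pos.ne')
  have := sum_words_union_eq_occMean hF g n ∅ (empty_subset _)
  rw [card_empty] at this
  rw [wordMean, div_eq_iff hF0, mul_comm, ← this]
  refine sum_congr rfl fun x _ => ?_
  rw [h _ (image_nonempty.2 ⟨⟨0, hn⟩, mem_univ _⟩), empty_union]

theorem image_swap_of_mem {V : Finset α} {a b : α} (ha : a ∈ V) (hb : b ∈ V) :
    V.image (Equiv.swap a b) = V := by
  refine eq_of_subset_of_card_le ?_ (card_image_of_injective _ (Equiv.injective _)).ge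
  intro c hc
  obtain ⟨d, hd, rfl⟩ := mem_image.1 hc
  rw [Equiv.swap_apply_def]
  split_ifs <;> assumption

theorem image_swap_of_notMem {V : Finset α} {a b : α} (ha : a ∉ V) (hb : b ∉ V) :
    V.image (Equiv.swap a b) = V := by
  refine eq_of_subset_of_card_le ?_ (card_image_of_injective _ (Equiv.injective _)).ge
  intro c hc
  obtain ⟨d, hd, rfl⟩ := mem_image.1 hc
  rwa [Equiv.swap_apply_of_ne_of_ne (by rintro rfl; exact ha hd) (by rintro rfl; exact hb hd)]

/-- Two sets of the same size are joined by replacing one value at a time. -/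
theorem abs_sub_le_card_sdiff {Φ : Finset α → ℝ} {s : ℝ}
    (h : ∀ V a b, |Φ V - Φ (V.image (Equiv.swap a b))| ≤ s) (W : Finset α) (d : ℕ)
    (V : Finset α) (hVW : #V = #W) (hd : #(V \ W) = d) : |Φ V - Φ W| ≤ d * s := by
  induction d generalizing V with
  | zero =>
    have : V = W := eq_of_subset_of_card_le (sdiff_eq_empty_iff_subset.1 (card_eq_zero.1 hd))
      hVW.ge
    simp [this]
  | succ d ih =>
    obtain ⟨a, ha⟩ : (V \ W).Nonempty := card_pos.1 (by omega)
    obtain ⟨b, hb⟩ : (W \ V).Nonempty :=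
      card_pos.1 (by rw [← card_sdiff_comm hVW]; omega)
    rw [mem_sdiff] at ha hb
    have hcard := card_image_of_injective V (Equiv.swap a b).injective
    have key : V.image (Equiv.swap a b) \ W = (V \ W).erase a := by
      ext c
      simp only [mem_sdiff, mem_image, mem_erase]
      constructor
      · rintro ⟨⟨e, he, rfl⟩, hc⟩
        rw [Equiv.swap_apply_def] at hc ⊢
        split_ifs at hc ⊢ with h1 h2
        · exact absurd hb.1 hc
        · exact absurd (h2 ▸ he) hb.2
        · exact ⟨h1, he, hc⟩
      · rintro ⟨h1, h2, h3⟩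
        exact ⟨⟨c, h2, Equiv.swap_apply_of_ne_of_ne h1 (by rintro rfl; exact h3 hb.1)⟩, h3⟩
    have h1 := ih _ (hcard.trans hVW)
      (by rw [key, card_erase_of_mem (mem_sdiff.2 ha), hd]; rfl)
    have h2 := h V a b
    have h3 := abs_sub_le (Φ V) (Φ (V.image (Equiv.swap a b))) (Φ W)
    push_cast
    linarith

end Words

/-! ### The chain of value sets -/

section ValueSets

variable {α : Type*} [Fintype α] [DecidableEq α]

/-- The pointwise stabilizer of a set of values. -/
def pointStab (V : Finset α) : Finset (Equiv.Perm α) :=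
  univ.filter fun σ => ∀ a ∈ V, σ a = a

@[simp] theorem mem_pointStab {V : Finset α} {σ : Equiv.Perm α} :
    σ ∈ pointStab V ↔ ∀ a ∈ V, σ a = a := by
  simp [pointStab]

/-- The mean of `θ` over the pointwise stabilizer of `V`. -/
def stabMean (θ : Equiv.Perm α → ℝ) (V : Finset α) : ℝ :=
  (∑ σ ∈ pointStab V, θ σ) / #(pointStab V)

/-- The Markov operator of the chain of value sets: choose a uniform permutation fixing `V`
pointwise, then a uniform word in its fixed points, and take the values of this word. -/
def setStep (n : ℕ) (Φ : Finset α → ℝ) : Finset α → ℝ :=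
  stabMean fun σ => wordMean n Φ (fixedPts σ)

theorem pointStab_pos (V : Finset α) : (0 : ℝ) < #(pointStab V) := by
  exact_mod_cast card_pos.2 ⟨1, by simp⟩

theorem stabMean_mem_Icc {θ : Equiv.Perm α → ℝ} (h : ∀ σ, θ σ ∈ Set.Icc (0 : ℝ) 1)
    (V : Finset α) : stabMean θ V ∈ Set.Icc (0 : ℝ) 1 := by
  refine ⟨div_nonneg (sum_nonneg fun σ _ => (h σ).1) (by positivity), ?_⟩
  rw [stabMean, div_le_one (pointStab_pos V)]
  exact (sum_le_sum fun σ _ => (h σ).2).trans_eq (by simp)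

theorem iterate_setStep_mem_Icc {Φ : Finset α → ℝ} (h : ∀ V, Φ V ∈ Set.Icc (0 : ℝ) 1) (n t : ℕ)
    (V : Finset α) : (setStep n)^[t] Φ V ∈ Set.Icc (0 : ℝ) 1 := by
  induction t generalizing V with
  | zero => exact h V
  | succ t ih =>
    rw [Function.iterate_succ_apply']
    exact stabMean_mem_Icc (fun σ => wordMean_mem_Icc ih n _) V

theorem fixedPts_conj (τ σ : Equiv.Perm α) :
    fixedPts (τ * σ * τ⁻¹) = (fixedPts σ).image τ := by
  ext a
  simp only [mem_fixedPts, mem_image, Equiv.Perm.coe_mul, Function.comp]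
  constructor
  · intro h; exact ⟨τ⁻¹ a, by apply τ.injective; simpa using h, by simp⟩
  · rintro ⟨b, hb, rfl⟩; simp [hb]

theorem stabMean_image (θ : Equiv.Perm α → ℝ) (τ : Equiv.Perm α) (V : Finset α) :
    stabMean θ (V.image τ) = stabMean (fun σ => θ (τ * σ * τ⁻¹)) V := by
  have hmem : ∀ σ, σ ∈ pointStab V ↔
      (MulAut.conj τ).toEquiv σ ∈ pointStab (V.image τ) := by
    intro σ; simp
  rw [stabMean, stabMean, card_equiv (MulAut.conj τ).toEquiv hmem]
  congr 1
  exact (sum_equiv (MulAut.conj τ).toEquiv hmem (by simp)).symm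

/-- The chain of value sets commutes with renaming the values. -/
theorem setStep_image (n : ℕ) (Φ : Finset α → ℝ) (τ : Equiv.Perm α) (V : Finset α) :
    setStep n Φ (V.image τ) = setStep n (fun V => Φ (V.image τ)) V := by
  simp only [setStep, stabMean_image, fixedPts_conj, wordMean_image]

theorem fixedPts_ofSubtype (V : Finset α) (σ : Equiv.Perm {a // a ∉ V}) :
    #(fixedPts (Equiv.Perm.ofSubtype σ)) = #V + #(fixedPts σ) := by
  have : fixedPts (Equiv.Perm.ofSubtype σ) =
      V.disjUnion ((fixedPts σ).map (Function.Embedding.subtype _)) (by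
        rw [disjoint_left]; intro a ha; simp [ha]) := by
    ext a
    simp only [mem_fixedPts, mem_disjUnion, mem_map, Function.Embedding.subtype_apply,
      Subtype.exists, exists_and_right, exists_eq_right]
    by_cases ha : a ∈ V
    · simp [ha, Equiv.Perm.ofSubtype_apply_of_not_mem (p := fun a => a ∉ V) σ (not_not.2 ha)]
    · rw [Equiv.Perm.ofSubtype_apply_of_mem (p := fun a => a ∉ V) σ ha]
      simp [ha, Subtype.ext_iff]
  rw [this, card_disjUnion, card_map]

/-- The pointwise stabilizer of `V` is the group of permutations of the complement of `V`. -/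
theorem sum_pointStab (V : Finset α) (g : ℕ → ℝ) :
    ∑ σ ∈ pointStab V, g #(fixedPts σ) =
      (Fintype.card α - #V).factorial * fixMean (Fintype.card α - #V) (fun N => g (#V + N)) := by
  have hc : Fintype.card {a // a ∉ V} = Fintype.card α - #V := by
    rw [Fintype.card_subtype_compl]; simp
  have h := sum_perm_fixedPts (β := {a // a ∉ V}) fun N => g (#V + N)
  rw [hc] at h
  rw [← h]
  symm
  refine sum_bij (fun σ _ => Equiv.Perm.ofSubtype σ) ?_ ?_ ?_ ?_
  · intro σ _
    rw [mem_pointStab]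
    intro a ha
    exact Equiv.Perm.ofSubtype_apply_of_not_mem (p := fun a => a ∉ V) σ (not_not.2 ha)
  · intro σ _ σ' _ h; exact Equiv.Perm.ofSubtype_injective h
  · intro σ hσ
    rw [mem_pointStab] at hσ
    have hmaps : ∀ a, σ a ∉ V ↔ a ∉ V := by
      refine fun a => not_congr ⟨fun ha => ?_, fun ha => ?_⟩
      · have := hσ _ ha; rwa [σ.injective this] at ha
      · rwa [hσ a ha]
    exact ⟨σ.subtypePerm hmaps, mem_univ _,
      Equiv.Perm.ofSubtype_subtypePerm hmaps fun a h ha => h (hσ a ha)⟩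
  · intro σ _; rw [fixedPts_ofSubtype]

theorem card_pointStab (V : Finset α) : #(pointStab V) = (Fintype.card α - #V).factorial := by
  have h := sum_pointStab V fun _ => 1
  rw [fixMean_const] at h
  simp only [sum_const, nsmul_eq_mul, mul_one] at h
  exact_mod_cast h

/-- On functions of the number of values, the chain of value sets is the size chain. -/
theorem setStep_eq_sizeStep {n : ℕ} (hn : 1 ≤ n) {Φ : Finset α → ℝ} {g : ℕ → ℝ}
    (h : ∀ V : Finset α, V.Nonempty → Φ V = g #V) {V : Finset α} (hV : V.Nonempty) :
    setStep n Φ V = sizeStep n (Fintype.card α) g #V := by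
  rw [setStep, stabMean, div_eq_iff (pointStab_pos V).ne', card_pointStab, mul_comm, sizeStep,
    ← sum_pointStab V fun f => occMean f g n 0]
  refine sum_congr rfl fun σ hσ => wordMean_eq_occMean hn h ?_
  exact hV.mono fun a ha => by simpa using mem_pointStab.1 hσ a ha

theorem iterate_setStep_eq_sizeStep {n : ℕ} (hn : 1 ≤ n) {Φ : Finset α → ℝ} {g : ℕ → ℝ}
    (h : ∀ V : Finset α, V.Nonempty → Φ V = g #V) (t : ℕ) {V : Finset α} (hV : V.Nonempty) :
    (setStep n)^[t] Φ V = (sizeStep n (Fintype.card α))^[t] g #V := by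
  induction t generalizing V with
  | zero => exact h V hV
  | succ t ih =>
    rw [Function.iterate_succ_apply', Function.iterate_succ_apply']
    exact setStep_eq_sizeStep hn (fun W hW => ih hW) hV

/-! ### Replacing one value -/

/-- The main case of `setStep_swap`. The chance `1 / (k - |V|)` that `b` is fixed is at least
`1 / k`. -/
theorem setStep_swap_of_mem {n : ℕ} {Φ : Finset α → ℝ} {s : ℝ}
    (hs : 0 ≤ s) (h : ∀ V a b, |Φ V - Φ (V.image (Equiv.swap a b))| ≤ s)
    {V : Finset α} {a b : α} (ha : a ∈ V) (hb : b ∉ V) :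
    |setStep n Φ V - setStep n Φ (V.image (Equiv.swap a b))| ≤
      (1 - 1 / (Fintype.card α : ℝ)) * s := by
  rw [setStep_image]
  set Φ' : Finset α → ℝ := fun V => Φ (V.image (Equiv.swap a b)) with hΦ'
  have hVk : #V < Fintype.card α := by
    rw [← card_univ]; exact card_lt_card ((ssubset_univ_iff).2 fun e => hb (e ▸ mem_univ b))
  have hterm : ∀ σ ∈ pointStab V,
      |wordMean n Φ (fixedPts σ) - wordMean n Φ' (fixedPts σ)| ≤
        s - if σ ∈ pointStab (insert b V) then s else 0 := by
    intro σ hσ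
    split_ifs with hσb
    · rw [mem_pointStab] at hσb
      have e : (fixedPts σ).image (Equiv.swap a b) = fixedPts σ :=
        image_swap_of_mem (by simpa using hσb a (mem_insert_of_mem ha))
          (by simpa using hσb b (mem_insert_self _ _))
      rw [hΦ', ← wordMean_image, e]; simp
    · rw [sub_zero]; exact abs_wordMean_sub_le n hs fun W => h W a b
  have hsub : pointStab (insert b V) ⊆ pointStab V := fun σ hσ =>
    mem_pointStab.2 fun c hc => mem_pointStab.1 hσ c (mem_insert_of_mem hc)
  have hfac : (#(pointStab V) : ℝ) = (Fintype.card α - #V : ℝ) * #(pointStab (insert b V)) := by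
    rw [card_pointStab, card_pointStab, card_insert_of_notMem hb,
      show Fintype.card α - #V = (Fintype.card α - (#V + 1)) + 1 by omega, Nat.factorial_succ,
      Nat.cast_mul]
    congr 1
    rw [show Fintype.card α - (#V + 1) + 1 = Fintype.card α - #V by omega,
      Nat.cast_sub hVk.le]
  have hVk' : (0 : ℝ) < Fintype.card α - #V := by
    rw [sub_pos]; exact_mod_cast hVk
  have hpos := pointStab_pos (insert b V)
  rw [setStep, setStep, stabMean, stabMean, ← sub_div, ← sum_sub_distrib, abs_div,
    abs_of_pos (pointStab_pos V), div_le_iff₀ (pointStab_pos V)]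
  calc _ ≤ ∑ σ ∈ pointStab V, (s - if σ ∈ pointStab (insert b V) then s else 0) :=
        (abs_sum_le_sum_abs _ _).trans (sum_le_sum hterm)
    _ = s * (#(pointStab V) - #(pointStab (insert b V))) := by
        rw [sum_sub_distrib, ← sum_filter, filter_mem_eq_inter, inter_eq_right.2 hsub]
        simp only [sum_const, nsmul_eq_mul]; ring
    _ = (1 - 1 / (Fintype.card α - #V : ℝ)) * s * #(pointStab V) := by
        rw [hfac]; field_simp
    _ ≤ _ := by
        refine mul_le_mul_of_nonneg_right (mul_le_mul_of_nonneg_right ?_ hs) (by positivity)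
        have : 1 / (Fintype.card α : ℝ) ≤ 1 / (Fintype.card α - #V : ℝ) :=
          one_div_le_one_div_of_le hVk' (by simp)
        linarith

/-- Replacing one value by another: the chains from `V` and from the renamed set use conjugate
permutations, and they meet when the other value is a fixed point. -/
theorem setStep_swap {n : ℕ} {Φ : Finset α → ℝ} {s : ℝ}
    (hs : 0 ≤ s) (h : ∀ V a b, |Φ V - Φ (V.image (Equiv.swap a b))| ≤ s)
    (V : Finset α) (a b : α) :
    |setStep n Φ V - setStep n Φ (V.image (Equiv.swap a b))| ≤
      (1 - 1 / (Fintype.card α : ℝ)) * s := by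
  have : 0 ≤ (1 - 1 / (Fintype.card α : ℝ)) * s := by
    refine mul_nonneg ?_ hs
    have hk : (1 : ℝ) ≤ Fintype.card α := by
      exact_mod_cast Fintype.card_pos_iff.2 ⟨a⟩
    rw [sub_nonneg, div_le_one (by linarith)]; exact hk
  by_cases ha : a ∈ V <;> by_cases hb : b ∈ V
  · rw [image_swap_of_mem ha hb]; simpa using this
  · exact setStep_swap_of_mem hs h ha hb
  · rw [Equiv.swap_comm]; exact setStep_swap_of_mem hs h hb ha
  · rw [image_swap_of_notMem ha hb]; simpa using this

theorem iterate_setStep_swap {n : ℕ} {Φ : Finset α → ℝ}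
    (h : ∀ V, Φ V ∈ Set.Icc (0 : ℝ) 1) (t : ℕ) (V : Finset α) (a b : α) :
    |(setStep n)^[t] Φ V - (setStep n)^[t] Φ (V.image (Equiv.swap a b))| ≤
      (1 - 1 / (Fintype.card α : ℝ)) ^ t := by
  have hk : (1 : ℝ) ≤ Fintype.card α := by
    exact_mod_cast Fintype.card_pos_iff.2 ⟨a⟩
  have h0 : 0 ≤ 1 - 1 / (Fintype.card α : ℝ) := by
    rw [sub_nonneg, div_le_one (by linarith)]; exact hk
  induction t generalizing V a b with
  | zero => simpa using abs_sub_le_of_le_of_le (h V).1 (h V).2 (h _).1 (h _).2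
  | succ t ih =>
    rw [Function.iterate_succ_apply', pow_succ']
    exact setStep_swap (pow_nonneg h0 t) ih V a b

/-! ### Symmetrization -/

/-- The mean of `Φ` over all renamings of the values. -/
def symMean (Φ : Finset α → ℝ) (V : Finset α) : ℝ :=
  (∑ τ : Equiv.Perm α, Φ (V.image τ)) / (Fintype.card α).factorial

theorem setStep_symMean (n : ℕ) (Φ : Finset α → ℝ) :
    setStep n (symMean Φ) = symMean (setStep n Φ) := by
  funext V
  simp only [symMean.eq_1 (setStep n Φ), setStep_image]
  simp only [setStep, stabMean, wordMean, symMean, sum_div]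
  rw [sum_comm]
  refine sum_congr rfl fun σ _ => ?_
  rw [sum_comm]
  refine sum_congr rfl fun τ _ => sum_congr rfl fun x _ => ?_
  ring

theorem iterate_setStep_symMean (n t : ℕ) (Φ : Finset α → ℝ) :
    (setStep n)^[t] (symMean Φ) = symMean ((setStep n)^[t] Φ) := by
  induction t with
  | zero => rfl
  | succ t ih => rw [Function.iterate_succ_apply', Function.iterate_succ_apply', ih,
      setStep_symMean]

theorem exists_image_eq {V W : Finset α} (h : #V = #W) : ∃ τ : Equiv.Perm α, V.image τ = W := by
  let e : {a // a ∈ V} ≃ {a // a ∈ W} := equivOfCardEq h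
  refine ⟨e.extendSubtype, eq_of_subset_of_card_le ?_ ?_⟩
  · intro b hb
    obtain ⟨a, ha, rfl⟩ := mem_image.1 hb
    exact e.extendSubtype_mem a ha
  · rw [card_image_of_injective _ (Equiv.injective _), h]

theorem symMean_eq_of_card_eq (Φ : Finset α → ℝ) {V W : Finset α} (h : #V = #W) :
    symMean Φ V = symMean Φ W := by
  obtain ⟨τ, rfl⟩ := exists_image_eq h
  rw [symMean, symMean]
  congr 1
  refine (Fintype.sum_equiv (Equiv.mulRight τ) _ _ fun ρ => ?_).symm
  rw [image_image]; rfl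

theorem exists_symMean_eq (Φ : Finset α → ℝ) : ∃ g : ℕ → ℝ, ∀ V, symMean Φ V = g #V :=
  ⟨Function.extend card (symMean Φ) 0, fun V =>
    (Function.FactorsThrough.extend_apply (f := card) (g := symMean Φ)
      (fun _ _ h => symMean_eq_of_card_eq Φ h) _ V).symm⟩

theorem symMean_mem_Icc {Φ : Finset α → ℝ} (h : ∀ V, Φ V ∈ Set.Icc (0 : ℝ) 1) (V : Finset α) :
    symMean Φ V ∈ Set.Icc (0 : ℝ) 1 := by
  refine ⟨div_nonneg (sum_nonneg fun τ _ => (h _).1) (by positivity), ?_⟩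
  rw [symMean, div_le_one (by positivity)]
  exact (sum_le_sum fun τ _ => (h _).2).trans_eq (by simp [Fintype.card_perm])

theorem abs_sub_symMean_le {Φ : Finset α → ℝ} {s : ℝ} (hs : 0 ≤ s)
    (h : ∀ V a b, |Φ V - Φ (V.image (Equiv.swap a b))| ≤ s) (V : Finset α) :
    |Φ V - symMean Φ V| ≤ #V * s := by
  have hf : (0 : ℝ) < (Fintype.card α).factorial := by positivity
  have e : Φ V - symMean Φ V =
      (∑ τ : Equiv.Perm α, (Φ V - Φ (V.image τ))) / (Fintype.card α).factorial := by
    rw [sum_sub_distrib, symMean, sub_div]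
    simp [Fintype.card_perm, hf.ne']
  rw [e, abs_div, abs_of_pos hf, div_le_iff₀ hf]
  refine (abs_sum_le_sum_abs _ _).trans ((sum_le_sum fun τ _ => ?_).trans_eq
    (b := ∑ τ : Equiv.Perm α, #V * s) (by simp [Fintype.card_perm]; ring))
  refine (abs_sub_le_card_sdiff h (V.image τ) _ V
    (card_image_of_injective _ τ.injective).symm rfl).trans ?_
  exact mul_le_mul_of_nonneg_right (by exact_mod_cast card_le_card sdiff_subset) hs

/-! ### Oscillation of the iterates -/

/-- The chain of value sets forgets its starting point at the rate `1 - 1 / (2 k)`. -/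
theorem abs_iterate_setStep_sub_le {n : ℕ} (hn : 1 ≤ n) (hnk : n ≤ Fintype.card α)
    {Φ : Finset α → ℝ} (hΦ : ∀ V, Φ V ∈ Set.Icc (0 : ℝ) 1) (t : ℕ) {V W : Finset α}
    (hV : V.Nonempty) (hW : W.Nonempty) (hVn : #V ≤ n) (hWn : #W ≤ n) :
    |(setStep n)^[t] Φ V - (setStep n)^[t] Φ W| ≤
      n * (1 - 1 / (2 * (Fintype.card α : ℝ))) ^ t := by
  set k := Fintype.card α with hk
  have hk1 : (1 : ℝ) ≤ k := by exact_mod_cast hn.trans hnk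
  have hn1 : (1 : ℝ) ≤ n := by exact_mod_cast hn
  set q : ℝ := (1 - 1 / (2 * (k : ℝ))) ^ t with hq
  -- If `n q ≥ 1` the bound is trivial, as `Φ` takes values in `[0, 1]`.
  rcases le_total 1 ((n : ℝ) * q) with h1 | h1
  · have a := iterate_setStep_mem_Icc hΦ n t V
    have b := iterate_setStep_mem_Icc hΦ n t W
    exact (abs_sub_le_of_le_of_le a.1 a.2 b.1 b.2).trans (by simpa using h1)
  have hb0 : (0 : ℝ) ≤ 1 - 1 / (2 * k) := by
    rw [sub_nonneg, div_le_one (by positivity)]; linarith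
  have hb1 : 1 - 1 / (2 * k : ℝ) ≤ 1 := by
    have : (0 : ℝ) ≤ 1 / (2 * k) := by positivity
    linarith
  have hq0 : 0 ≤ q := pow_nonneg hb0 t
  have hq1 : q ≤ 1 := pow_le_one₀ hb0 hb1
  have hc0 : (0 : ℝ) ≤ 1 - 1 / k := by
    rw [sub_nonneg, div_le_one (by positivity)]; exact hk1
  have hs0 : (0 : ℝ) ≤ (1 - 1 / (k : ℝ)) ^ t := pow_nonneg hc0 t
  have hs : (1 - 1 / (k : ℝ)) ^ t ≤ q * q := by
    rw [hq, ← mul_pow, ← sq]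
    exact pow_le_pow_left₀ hc0 (one_sub_le_sq (hn.trans hnk)) t
  have hsw := fun V a b => iterate_setStep_swap (n := n) hΦ t V a b
  wlog hVW : #V ≤ #W generalizing V W
  · rw [abs_sub_comm]; exact this hW hV hWn hVn (by omega)
  rcases hVW.eq_or_lt with he | hlt
  · refine (abs_sub_le_card_sdiff hsw W _ V he rfl).trans ?_
    have h2 : (#(V \ W) : ℝ) ≤ n := by
      exact_mod_cast (card_le_card sdiff_subset).trans hVn
    have h3 : q * q ≤ q := by nlinarith
    exact mul_le_mul h2 (hs.trans h3) hs0 (by positivity)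
  -- For different sizes, compare both values with their symmetrizations. The replacements cost
  -- `(|V| + |W|) q² ≤ (2 n - 1) q / n`, the sizes `(n - 1)² / n * q`, which add up to `n q`.
  · have hV1 : 1 ≤ #V := hV.card_pos
    have hn2 : 2 ≤ n := by omega
    obtain ⟨g, hg⟩ := exists_symMean_eq Φ
    have hsym : ∀ U : Finset α, U.Nonempty →
        symMean ((setStep n)^[t] Φ) U = (sizeStep n k)^[t] g #U := by
      intro U hU
      rw [← iterate_setStep_symMean]
      exact iterate_setStep_eq_sizeStep hn (fun V _ => hg V) t hU
    have hg01 : ∀ j, 1 ≤ j → j ≤ n → 0 ≤ g j ∧ g j ≤ 1 := by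
      intro j _ hj
      obtain ⟨U, -, rfl⟩ := exists_subset_card_eq (s := (univ : Finset α)) (n := j)
        (by rw [card_univ]; omega)
      rw [← hg]
      exact symMean_mem_Icc hΦ U
    have e1 := abs_sub_symMean_le hs0 hsw V
    have e2 := abs_sub_symMean_le hs0 hsw W
    have e3 := sizeStep_contraction hn2 hnk t h1 hg01 hV1 hlt.le hWn
    rw [hsym V hV] at e1
    rw [hsym W hW] at e2
    have hsum : (#V : ℝ) + #W ≤ 2 * n - 1 := by
      have : #V + #W + 1 ≤ 2 * n := by omega
      have : (#V : ℝ) + #W + 1 ≤ 2 * n := by exact_mod_cast this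
      linarith
    have e4 : (#V : ℝ) * (1 - 1 / (k : ℝ)) ^ t + #W * (1 - 1 / (k : ℝ)) ^ t ≤
        (2 * n - 1) * (q / n) := by
      rw [← add_mul]
      refine mul_le_mul hsum (hs.trans ?_) hs0 (by linarith)
      rw [le_div_iff₀ (by linarith)]
      nlinarith
    have e5 : (2 * n - 1) * (q / n) + (n - 1) * ((n - 1) / n * q) = n * q := by
      field_simp; ring
    rw [abs_le] at *
    constructor <;> linarith [e1.1, e1.2, e2.1, e2.2, e3.1, e3.2]

end ValueSets

/-! ### The dual Burnside kernel of the value-permutation model -/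

theorem wordMean_le {α : Type*} [DecidableEq α] {n : ℕ} (hn : 1 ≤ n) {Φ : Finset α → ℝ} {b : ℝ}
    (h : ∀ V : Finset α, V.Nonempty → #V ≤ n → Φ V ≤ b) {F : Finset α} (hF : F.Nonempty) :
    wordMean n Φ F ≤ b := by
  have hF0 : (0 : ℝ) < (#F : ℝ) ^ n := pow_pos (by exact_mod_cast hF.card_pos) _
  rw [wordMean, div_le_iff₀ hF0]
  refine (sum_le_sum fun x _ => h _ (image_nonempty.2 ⟨⟨0, hn⟩, mem_univ _⟩)
    (card_image_le.trans (by simp))).trans_eq ?_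
  simp [mul_comm]

theorem le_wordMean {α : Type*} [DecidableEq α] {n : ℕ} (hn : 1 ≤ n) {Φ : Finset α → ℝ} {b : ℝ}
    (h : ∀ V : Finset α, V.Nonempty → #V ≤ n → b ≤ Φ V) {F : Finset α} (hF : F.Nonempty) :
    b ≤ wordMean n Φ F := by
  have hF0 : (0 : ℝ) < (#F : ℝ) ^ n := pow_pos (by exact_mod_cast hF.card_pos) _
  rw [wordMean, le_div_iff₀ hF0]
  refine Eq.trans_le ?_ (sum_le_sum fun x _ => h _ (image_nonempty.2 ⟨⟨0, hn⟩, mem_univ _⟩)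
    (card_image_le.trans (by simp)))
  simp [mul_comm]

theorem value_smul_eq_iff {n k : ℕ} {g : Equiv.Perm (Fin k)} {x : Fin n → Fin k} :
    g • x = x ↔ ∀ i, g (x i) = x i :=
  funext_iff

theorem card_fixedBy_word {n k : ℕ} (g : Equiv.Perm (Fin k)) :
    (Nat.card (MulAction.fixedBy (Fin n → Fin k) g) : ℝ) = (#(fixedPts g) : ℝ) ^ n := by
  have : MulAction.fixedBy (Fin n → Fin k) g =
      (Fintype.piFinset fun _ : Fin n => fixedPts g : Finset (Fin n → Fin k)) := by
    ext x; simp [value_smul_eq_iff]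
  rw [this, Nat.card_coe_set_eq, Set.ncard_coe_finset]
  simp

theorem card_stabilizer_word {n k : ℕ} (x : Fin n → Fin k) :
    Nat.card (MulAction.stabilizer (Equiv.Perm (Fin k)) x) =
      #(pointStab (univ.image x)) := by
  have : (MulAction.stabilizer (Equiv.Perm (Fin k)) x : Set (Equiv.Perm (Fin k))) =
      (pointStab (univ.image x) : Finset (Equiv.Perm (Fin k))) := by
    ext σ
    simp only [SetLike.mem_coe, MulAction.mem_stabilizer_iff, mem_pointStab, mem_image, mem_univ,
      true_and, forall_exists_index, forall_apply_eq_imp_iff, funext_iff]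
    rfl
  rw [← Set.ncard_coe_finset, ← this]
  rfl

/-- One step of the dual Burnside chain: a uniform word in the fixed points, then a uniform
permutation fixing its values. -/
theorem valueDual_mulVec {n k : ℕ} (θ : Equiv.Perm (Fin k) → ℝ)
    (g : DualState (Equiv.Perm (Fin k)) (Fin n → Fin k)) :
    (valueDual n k).mulVec (fun h => θ h.1) g = wordMean n (stabMean θ) (fixedPts g.1) := by
  classical
  have hsum : ∀ x : Fin n → Fin k,
      ∑ h : DualState (Equiv.Perm (Fin k)) (Fin n → Fin k),
        (if x ∈ MulAction.fixedBy (Fin n → Fin k) h.1 then θ h.1 else 0) =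
      ∑ σ ∈ pointStab (univ.image x), θ σ := by
    intro x
    rw [← sum_filter]
    refine sum_bij (fun h _ => h.1) ?_ ?_ ?_ ?_
    · intro h hh
      simpa [value_smul_eq_iff] using hh
    · intro h _ h' _ e; exact Subtype.ext e
    · intro σ hσ
      have hx : x ∈ MulAction.fixedBy (Fin n → Fin k) σ := by
        simpa [value_smul_eq_iff] using hσ
      exact ⟨⟨σ, ⟨x, hx⟩⟩, by simpa using hx, rfl⟩
    · intro h _; rfl
  have hfil : (Fintype.piFinset fun _ : Fin n => fixedPts g.1) =
      univ.filter fun x => x ∈ MulAction.fixedBy (Fin n → Fin k) g.1 := by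
    ext x; simp [value_smul_eq_iff]
  simp only [wordMean, stabMean, ← hsum, hfil, Matrix.mulVec, dotProduct, valueDual, dualBurnside,
    card_fixedBy_word, card_stabilizer_word, sum_div, sum_mul]
  simp only [sum_filter, Set.mem_inter_iff]
  rw [sum_comm]
  refine sum_congr rfl fun x _ => ?_
  by_cases hx : x ∈ MulAction.fixedBy (Fin n → Fin k) g.1
  · simp only [hx, true_and, if_true]
    refine sum_congr rfl fun h _ => ?_
    split_ifs <;> ring
  · simp [hx]

/-- The powers of the dual kernel in terms of the chain of value sets. -/
theorem valueDual_pow_succ_mulVec {n k : ℕ}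
    [DecidableEq (DualState (Equiv.Perm (Fin k)) (Fin n → Fin k))]
    (θ : Equiv.Perm (Fin k) → ℝ) (s : ℕ)
    (g : DualState (Equiv.Perm (Fin k)) (Fin n → Fin k)) :
    (valueDual n k ^ (s + 1)).mulVec (fun h => θ h.1) g =
      wordMean n ((setStep n)^[s] (stabMean θ)) (fixedPts g.1) := by
  induction s generalizing g with
  | zero => rw [pow_one]; exact valueDual_mulVec θ g
  | succ s ih =>
    rw [pow_succ', ← Matrix.mulVec_mulVec, funext ih, Function.iterate_succ_apply']
    exact valueDual_mulVec (fun σ => wordMean n ((setStep n)^[s] (stabMean θ)) (fixedPts σ)) g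

theorem fixedPts_nonempty {n k : ℕ} (hn : 1 ≤ n)
    (g : DualState (Equiv.Perm (Fin k)) (Fin n → Fin k)) : (fixedPts g.1).Nonempty := by
  obtain ⟨x, hx⟩ := g.2
  exact ⟨x ⟨0, hn⟩, mem_fixedPts.2 (value_smul_eq_iff.1 hx ⟨0, hn⟩)⟩

theorem valueDual_pow_succ_mulVec_sub_le {n k : ℕ}
    [DecidableEq (DualState (Equiv.Perm (Fin k)) (Fin n → Fin k))] (hn : 1 ≤ n) (hnk : n ≤ k)
    {θ : Equiv.Perm (Fin k) → ℝ} (hθ : ∀ σ, θ σ ∈ Set.Icc (0 : ℝ) 1) (s : ℕ)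
    (g g' : DualState (Equiv.Perm (Fin k)) (Fin n → Fin k)) :
    (valueDual n k ^ (s + 1)).mulVec (fun h => θ h.1) g -
      (valueDual n k ^ (s + 1)).mulVec (fun h => θ h.1) g' ≤
      n * (1 - 1 / (2 * (k : ℝ))) ^ s := by
  rw [valueDual_pow_succ_mulVec, valueDual_pow_succ_mulVec, sub_le_iff_le_add]
  refine wordMean_le hn (fun V hV hVn => ?_) (fixedPts_nonempty hn g)
  rw [← sub_le_iff_le_add']
  refine le_wordMean hn (fun W hW hWn => ?_) (fixedPts_nonempty hn g')
  have := abs_iterate_setStep_sub_le hn (by simpa using hnk) (stabMean_mem_Icc hθ) s hV hW hVn hWn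
  rw [Fintype.card_fin] at this
  linarith [le_abs_self ((setStep n)^[s] (stabMean θ) V - (setStep n)^[s] (stabMean θ) W)]

/-! ### Total variation -/

/-- The total variation distance is attained by the test function of the set where `μ ≥ ν`. -/
theorem tvDist_le {S : Type*} [Fintype S] {μ ν : S → ℝ} {c : ℝ} (hμν : ∑ s, μ s = ∑ s, ν s)
    (h : ∀ A : Set S, ∑ s, (μ s - ν s) * A.indicator 1 s ≤ c) : tvDist μ ν ≤ c := by
  classical
  refine le_trans (le_of_eq ?_) (h {s | ν s ≤ μ s})
  have e : ∀ s, |μ s - ν s| =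
      2 * ((μ s - ν s) * ({s | ν s ≤ μ s} : Set S).indicator 1 s) - (μ s - ν s) := by
    intro s
    by_cases hs : ν s ≤ μ s
    · rw [abs_of_nonneg (by linarith), Set.indicator_of_mem (by exact hs)]; simp; ring
    · rw [abs_of_neg (by linarith), Set.indicator_of_notMem (by exact hs)]; simp
  rw [tvDist, sum_congr rfl fun s _ => e s, sum_sub_distrib, ← mul_sum, sum_sub_distrib, hμν]
  ring

theorem vecMul_pow_eq {S : Type*} [Fintype S] [DecidableEq S] {P : Matrix S S ℝ} {π : S → ℝ}
    (h : Matrix.vecMul π P = π) (t : ℕ) : Matrix.vecMul π (P ^ t) = π := by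
  induction t with
  | zero => simp
  | succ t ih => rw [pow_succ, ← Matrix.vecMul_vecMul, ih, h]

theorem pow_mulVec_one_eq {S : Type*} [Fintype S] [DecidableEq S] {P : Matrix S S ℝ}
    (h : P.mulVec 1 = 1) (t : ℕ) : (P ^ t).mulVec 1 = 1 := by
  induction t with
  | zero => simp
  | succ t ih => rw [pow_succ, ← Matrix.mulVec_mulVec, h, ih]

theorem tvDist_valueDual_le {n k : ℕ}
    [DecidableEq (DualState (Equiv.Perm (Fin k)) (Fin n → Fin k))] (hn : 1 ≤ n) (hnk : n ≤ k)
    {π : DualState (Equiv.Perm (Fin k)) (Fin n → Fin k) → ℝ}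
    (hπ : IsStationaryDist (valueDual n k) π) (s : ℕ)
    (g : DualState (Equiv.Perm (Fin k)) (Fin n → Fin k)) :
    tvDist (fun h => (valueDual n k ^ (s + 1)) g h) π ≤ n * (1 - 1 / (2 * (k : ℝ))) ^ s := by
  classical
  obtain ⟨hπ0, hπ1, hπP⟩ := hπ
  have hrow : (valueDual n k).mulVec 1 = 1 := by
    funext g
    simp only [Matrix.mulVec, dotProduct, Pi.one_apply, mul_one]
    exact dualBurnside_row_sum g
  refine tvDist_le ?_ fun A => ?_
  · rw [hπ1]
    have := congrFun (pow_mulVec_one_eq hrow (s + 1)) g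
    simpa only [Matrix.mulVec, dotProduct, Pi.one_apply, mul_one] using this
  · set θ : Equiv.Perm (Fin k) → ℝ := (Subtype.val '' A).indicator 1 with hθ
    have hθ01 : ∀ σ, θ σ ∈ Set.Icc (0 : ℝ) 1 := by
      intro σ
      by_cases h : σ ∈ Subtype.val '' A
      · rw [hθ, Set.indicator_of_mem h]; simp
      · rw [hθ, Set.indicator_of_notMem h]; simp
    have hθA : ∀ h, A.indicator (fun _ => (1 : ℝ)) h = θ h.1 := by
      intro h
      by_cases hh : h ∈ A
      · rw [hθ, Set.indicator_of_mem hh, Set.indicator_of_mem (Set.mem_image_of_mem _ hh)]; rfl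
      · rw [hθ, Set.indicator_of_notMem hh, Set.indicator_of_notMem]
        rwa [Subtype.val_injective.mem_set_image]
    set u := (valueDual n k ^ (s + 1)).mulVec (fun h => θ h.1) with hu
    have hstat : ∑ h, π h * θ h.1 = ∑ h, π h * u h := by
      change π ⬝ᵥ (fun h => θ h.1) = π ⬝ᵥ u
      rw [hu, Matrix.dotProduct_mulVec, vecMul_pow_eq hπP]
    have hug : ∑ h, (valueDual n k ^ (s + 1)) g h * θ h.1 = u g := rfl
    calc _ = u g - ∑ h, π h * u h := by
          rw [← hug, ← hstat, ← sum_sub_distrib]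
          exact sum_congr rfl fun h _ => by rw [← sub_mul, ← hθA]; rfl
      _ = ∑ h, π h * (u g - u h) := by
          simp only [mul_sub, sum_sub_distrib, ← sum_mul, hπ1, one_mul]
      _ ≤ ∑ h, π h * (n * (1 - 1 / (2 * (k : ℝ))) ^ s) :=
          sum_le_sum fun h _ => mul_le_mul_of_nonneg_left
            (valueDual_pow_succ_mulVec_sub_le hn hnk hθ01 s g h) (hπ0 h)
      _ = _ := by rw [← sum_mul, hπ1, one_mul]

theorem worstDist_valueDual_le {n k : ℕ} (hn : 1 ≤ n) (hnk : n ≤ k)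
    {π : DualState (Equiv.Perm (Fin k)) (Fin n → Fin k) → ℝ}
    (hπ : IsStationaryDist (valueDual n k) π) (s : ℕ) :
    worstDist (valueDual n k) π (s + 1) ≤ n * (1 - 1 / (2 * (k : ℝ))) ^ s := by
  have hk : (1 : ℝ) ≤ k := by exact_mod_cast hn.trans hnk
  have hb0 : (0 : ℝ) ≤ 1 - 1 / (2 * k) := by
    rw [sub_nonneg, div_le_one (by positivity)]; linarith
  exact Real.iSup_le (fun g => @tvDist_valueDual_le n k (fun a b => Classical.propDecidable (a = b))
    hn hnk π hπ s g)
    (mul_nonneg (by positivity) (pow_nonneg hb0 s))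

theorem mul_pow_le_of_log_le {n k s : ℕ} {ε : ℝ} (hn : 1 ≤ n) (hk : 1 ≤ k) (hε : 0 < ε)
    (hs : 2 * (k : ℝ) * Real.log ((n : ℝ) / ε) ≤ s) :
    (n : ℝ) * (1 - 1 / (2 * (k : ℝ))) ^ s ≤ ε := by
  have hk' : (1 : ℝ) ≤ k := by exact_mod_cast hk
  have hn' : (0 : ℝ) < n := by exact_mod_cast hn
  have hb0 : (0 : ℝ) ≤ 1 - 1 / (2 * k) := by
    rw [sub_nonneg, div_le_one (by positivity)]; linarith
  have h1 : (1 - 1 / (2 * (k : ℝ))) ^ s ≤ Real.exp (-(s / (2 * k))) := by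
    calc _ ≤ Real.exp (-(1 / (2 * (k : ℝ)))) ^ s :=
          pow_le_pow_left₀ hb0 (Real.one_sub_le_exp_neg _) s
      _ = _ := by rw [← Real.exp_nat_mul]; congr 1; ring
  have h2 : Real.exp (-(s / (2 * k))) ≤ ε / n := by
    rw [← Real.exp_log (div_pos hε hn'), Real.exp_le_exp,
      show ε / n = ((n : ℝ) / ε)⁻¹ by rw [inv_div], Real.log_inv, neg_le_neg_iff,
      le_div_iff₀ (by positivity)]
    linarith
  calc _ ≤ (n : ℝ) * (ε / n) := mul_le_mul_of_nonneg_left (h1.trans h2) hn'.le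
    _ = ε := by field_simp

end

theorem theorem4p12 (n k : ℕ) (hn : 1 ≤ n) (hnk : n ≤ k)
    (π : DualState (Equiv.Perm (Fin k)) (Fin n → Fin k) → ℝ)
    (hπ : IsStationaryDist (valueDual n k) π) :
    (∀ t : ℕ, 1 ≤ t →
      worstDist (valueDual n k) π t ≤ (n : ℝ) * (1 - 1 / (2 * (k : ℝ))) ^ (t - 1)) ∧
    (∀ ε : ℝ, 0 < ε → ε < 1 →
      mixingTime (valueDual n k) π ε ≤
        ((1 + ⌈2 * (k : ℝ) * Real.log ((n : ℝ) / ε)⌉₊ : ℕ) : ℕ∞)) := by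
  refine ⟨fun t ht => ?_, fun ε hε _ => ?_⟩
  · obtain ⟨s, rfl⟩ : ∃ s, t = s + 1 := ⟨t - 1, by omega⟩
    exact worstDist_valueDual_le hn hnk hπ s
  · refine iInf₂_le _ ?_
    rw [add_comm 1]
    exact (worstDist_valueDual_le hn hnk hπ _).trans
      (mul_pow_le_of_log_le hn (hn.trans hnk) hε (Nat.le_ceil _))
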